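/- Let $d\ge 1$. For a random vector $X$ in $\mathbb{R}^d$ with probability density function $f_X$ (with respect to Lebesgue measure) and for $p>1$, let $$H_p(X)=\frac{1}{1-p}\log\int_{\mathbb{R}^d} f_X(x)^p\,dx\in[-\infty,\infty),\qquad \mathbf{V}_p(X)=\exp\Big(\frac{2}{d}H_p(X)\Big)\in[0,\infty)$$ be its Rényi entropy and Rényi entropy power of order $p$, where $H_p(X)=-\infty$ and $\mathbf{V}_p(X)=0$ if the integral diverges. Let $X$ and $Y$ be independent random vectors in $\mathbb{R}^d$ that have probability density functions, let $t\in(0,1)$, let $p>1$, and let $\alpha\ge\frac{p+1}{2}$. Then $\sqrt{t}\,X+\sqrt{1-t}\,Y$ has a probability density function, and $$\mathbf{V}_p(\sqrt{t}\,X+\sqrt{1-t}\,Y)^\alpha\;\ge\; t^\alpha\,\mathbf{V}_p(X)^\alpha+(1-t)^\alpha\,\mathbf{V}_p(Y)^\alpha .$$ -/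

import Mathlib

open MeasureTheory ProbabilityTheory

noncomputable section

/-- The Rényi differential entropy of order `p` of a random vector `X` in `ℝ^d`,
`H_p(X) = (1 / (1 - p)) log ∫ f_X(x)^p dx`, where `f_X` is the density of `X` with respect to
Lebesgue measure. It is extended-real valued: for `p > 1` it is `-∞` when the integral diverges. -/
def renyiEntropy {Ω : Type*} [MeasurableSpace Ω] {d : ℕ} (p : ℝ)
    (X : Ω → EuclideanSpace ℝ (Fin d)) (P : Measure Ω) : EReal :=
  ((1 / (1 - p) : ℝ) : EReal) *
    ENNReal.log (∫⁻ x : EuclideanSpace ℝ (Fin d), (pdf X P volume x) ^ p)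

/-- The Rényi entropy power of order `p`, `V_p(X) = exp ((2 / d) H_p(X))`, with the convention
`exp (-∞) = 0`. -/
def renyiEntropyPower {Ω : Type*} [MeasurableSpace Ω] {d : ℕ} (p : ℝ)
    (X : Ω → EuclideanSpace ℝ (Fin d)) (P : Measure Ω) : ENNReal :=
  EReal.exp (((2 / (d : ℝ) : ℝ) : EReal) * renyiEntropy p X P)

/-- The weighted sum `√t X + √(1 - t) Y` of two random vectors. -/
def weightedSum {Ω : Type*} {d : ℕ} (t : ℝ) (X Y : Ω → EuclideanSpace ℝ (Fin d)) :
    Ω → EuclideanSpace ℝ (Fin d) :=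
  fun ω => Real.sqrt t • X ω + Real.sqrt (1 - t) • Y ω

end

/-! The inequality follows from Young's convolution inequality with its sharp constant, used at an
exponent triple chosen from the data. Put `q = 1 - 1/p`. For `0 < l < 1` take reciprocal exponents
`1 - l q`, `1 - (1 - l) q` for the two densities and `q` for the dual function. Interpolating the
resulting norms between `L^1`, where the norm is one, and `L^p` gives `∫ (f * g)^p ≤ K^(d p) (∫
f^p)^l (∫ g^p)^(1-l)` with `K = youngConst`. Let `A`, `B` be the `α`-th entropy powers of the two
summands. Raised to the negative power that defines entropy power, the bound becomes a lower bound
by a constant times `A^l B^(1-l)`. At `l = A / (A + B)` this product is `(A + B) exp (-h(l))`, where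
`h` is binary entropy (`rpow_mul_rpow_entropy`). It remains that the constant is at least `exp
(h(l))`, a one-variable inequality valid for `α ≥ (p + 1) / 2` (`entropy_le_youngExponent`).

The sharp Young inequality is proved on the line by transport: each function is pushed monotonically
to a Gaussian, the three maps are combined into an injective map of the plane, and its Jacobian is
bounded below by weighted AM-GM (`young_trilinear_of_continuous_pos`). Approximation and Fatou reach
measurable functions, and the trilinear form tensorises to dimension `d`. -/

/-! ### The scalar inequality between binary entropy and Young's constant -/

/-- The exponent governing the sharp constant in Young's inequality. -/
noncomputable def youngExponent (c : ℝ) : ℝ := c * Real.log c - (1 - c) * Real.log (1 - c)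

/-- The expression is concave in `l` and vanishes at `0` and `1`. The factor `2 - q` is the one for
which its second derivative vanishes at `l = 1/2`. -/
theorem young_entropy_defect_nonneg {q : ℝ} (hq0 : 0 < q) (hq1 : q < 1) {l : ℝ}
    (hl0 : 0 ≤ l) (hl1 : l ≤ 1) :
    0 ≤ q ^ 2 * (Real.negMulLog l + Real.negMulLog (1 - l)) -
      (2 - q) * (Real.negMulLog (1 - l * q) + Real.negMulLog (1 - (1 - l) * q) -
        Real.negMulLog (1 - q)) := by
  set G : ℝ → ℝ := fun l => q ^ 2 * (Real.negMulLog l + Real.negMulLog (1 - l)) -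
      (2 - q) * (Real.negMulLog (1 - l * q) + Real.negMulLog (1 - (1 - l) * q) -
        Real.negMulLog (1 - q)) with hG
  have hconc : ConcaveOn ℝ (Set.Icc 0 1) G := by
    refine concaveOn_of_hasDerivWithinAt2_nonpos (convex_Icc 0 1)
      (f' := fun l => q ^ 2 * (Real.log (1 - l) - Real.log l) -
        (2 - q) * (q * (Real.log (1 - l * q) - Real.log (1 - (1 - l) * q))))
      (f'' := fun l => q ^ 2 * (-(1 - l)⁻¹ - l⁻¹) -
        (2 - q) * (q * (-q * (1 - l * q)⁻¹ - q * (1 - (1 - l) * q)⁻¹))) ?_ ?_ ?_ ?_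
    · have := Real.continuous_negMulLog
      fun_prop
    · intro x hx
      rw [interior_Icc] at hx
      have h1 : 0 < 1 - x := by linarith [hx.2]
      have h2 : 0 < 1 - x * q := by nlinarith [hx.1, hx.2]
      have h3 : 0 < 1 - (1 - x) * q := by nlinarith [hx.1, hx.2]
      have d1 := Real.hasDerivAt_negMulLog hx.1.ne'
      have d2 := (Real.hasDerivAt_negMulLog h1.ne').comp x ((hasDerivAt_id x).const_sub 1)
      have d3 := (Real.hasDerivAt_negMulLog h2.ne').comp x
        (((hasDerivAt_id x).mul_const q).const_sub 1)
      have d4 := (Real.hasDerivAt_negMulLog h3.ne').comp x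
        ((((hasDerivAt_id x).const_sub 1).mul_const q).const_sub 1)
      have := ((d1.add d2).const_mul (q ^ 2)).sub
        (((d3.add d4).sub_const (Real.negMulLog (1 - q))).const_mul (2 - q))
      exact (this.congr_deriv (by ring)).hasDerivWithinAt
    · intro x hx
      rw [interior_Icc] at hx
      have h1 : 0 < 1 - x := by linarith [hx.2]
      have h2 : 0 < 1 - x * q := by nlinarith [hx.1, hx.2]
      have h3 : 0 < 1 - (1 - x) * q := by nlinarith [hx.1, hx.2]
      have d1 := Real.hasDerivAt_log hx.1.ne'
      have d2 := (Real.hasDerivAt_log h1.ne').comp x ((hasDerivAt_id x).const_sub 1)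
      have d3 := (Real.hasDerivAt_log h2.ne').comp x
        (((hasDerivAt_id x).mul_const q).const_sub 1)
      have d4 := (Real.hasDerivAt_log h3.ne').comp x
        ((((hasDerivAt_id x).const_sub 1).mul_const q).const_sub 1)
      have := ((d2.sub d1).const_mul (q ^ 2)).sub (((d3.sub d4).const_mul q).const_mul (2 - q))
      exact (this.congr_deriv (by ring)).hasDerivWithinAt
    · intro x hx
      rw [interior_Icc] at hx
      have h0 := hx.1
      have h1 : 0 < 1 - x := by linarith [hx.2]
      have h2 : 0 < 1 - x * q := by nlinarith [hx.1, hx.2]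
      have h3 : 0 < 1 - (1 - x) * q := by nlinarith [hx.1, hx.2]
      -- Over a common denominator the numerator collapses to a multiple of `(1 - 2 x)^2`, so the
      -- sign is visible.
      have : q ^ 2 * (-(1 - x)⁻¹ - x⁻¹) -
        (2 - q) * (q * (-q * (1 - x * q)⁻¹ - q * (1 - (1 - x) * q)⁻¹)) =
        -(q ^ 2 * ((1 - q) * (1 - 2 * x) ^ 2)) *
          ((1 - x) * x * (1 - x * q) * (1 - (1 - x) * q))⁻¹ := by
        have h0' := h0.ne'
        have h1' := h1.ne'
        have h2' := h2.ne'
        have h3' := h3.ne'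
        generalize ha : 1 - x * q = a at h2' ⊢
        generalize hb : 1 - (1 - x) * q = b at h3' ⊢
        field_simp
        rw [← ha, ← hb]
        ring
      rw [this]
      have : 0 ≤ 1 - q := by linarith
      exact mul_nonpos_of_nonpos_of_nonneg (neg_nonpos.2 (by positivity)) (by positivity)
  have e0 : G 0 = 0 := by simp [hG]
  have e1 : G 1 = 0 := by simp [hG]
  have := hconc.2 (Set.left_mem_Icc.2 zero_le_one) (Set.right_mem_Icc.2 zero_le_one)
    (sub_nonneg.2 hl1) hl0 (by ring)
  rw [e0, e1] at this
  simpa only [smul_eq_mul, mul_zero, mul_one, zero_add, add_zero] using this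

/-- At the threshold value of `α` this is `young_entropy_defect_nonneg` rearranged; larger `α` only
helps because the bracket is nonnegative. With `q = 1 - 1/p` the threshold is `(p + 1) / 2`. -/
theorem entropy_le_youngExponent {q : ℝ} (hq0 : 0 < q) (hq1 : q < 1) {l : ℝ}
    (hl0 : 0 < l) (hl1 : l < 1) {α : ℝ} (hα : (2 - q) / (2 * (1 - q)) ≤ α) :
    Real.negMulLog l + Real.negMulLog (1 - l) ≤
      α / q * (youngExponent (1 - l * q) + youngExponent (1 - (1 - l) * q) +
        youngExponent q) := by
  have key := young_entropy_defect_nonneg hq0 hq1 hl0.le hl1.le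
  set h := Real.negMulLog l + Real.negMulLog (1 - l) with hh
  have hh0 : 0 ≤ h := add_nonneg (Real.negMulLog_nonneg hl0.le hl1.le)
    (Real.negMulLog_nonneg (by linarith) (by linarith))
  set R := Real.negMulLog (1 - l * q) + Real.negMulLog (1 - (1 - l) * q) -
        Real.negMulLog (1 - q) with hR
  have hD : youngExponent (1 - l * q) + youngExponent (1 - (1 - l) * q) +
        youngExponent q = q * h - R := by
    have e1 : Real.log (l * q) = Real.log l + Real.log q := Real.log_mul hl0.ne' hq0.ne'
    have e2 : Real.log ((1 - l) * q) = Real.log (1 - l) + Real.log q :=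
      Real.log_mul (by linarith) hq0.ne'
    simp only [hh, hR, youngExponent, Real.negMulLog, sub_sub_cancel, e1, e2]
    ring
  rw [hD]
  have hq2 : 0 < 2 * (1 - q) := by linarith
  have hb : h ≤ (2 - q) / (2 * (1 - q)) * ((q * h - R) / q) := by
    rw [div_mul_div_comm, le_div_iff₀ (by positivity)]
    nlinarith
  have hnn : 0 ≤ (q * h - R) / q := by
    by_contra hneg
    push Not at hneg
    have : 0 < (2 - q) / (2 * (1 - q)) := div_pos (by linarith) hq2
    nlinarith
  calc h ≤ _ := hb
    _ ≤ α * ((q * h - R) / q) := mul_le_mul_of_nonneg_right hα hnn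
    _ = _ := by ring

/-! ### Monotone transport on the line -/

/-- The cumulative distribution function of a continuous positive probability density. -/
theorem exists_primitive_range_Ioo {f : ℝ → ℝ} (hf : Continuous f) (hpos : ∀ x, 0 < f x)
    (hi : Integrable f) (h1 : ∫ x, f x = 1) :
    ∃ F : ℝ → ℝ, (∀ x, HasStrictDerivAt F (f x) x) ∧ StrictMono F ∧
      Set.range F = Set.Ioo 0 1 := by
  set C := ∫ x in Set.Iic (0 : ℝ), f x with hC
  set F : ℝ → ℝ := fun x => C + ∫ u in (0 : ℝ)..x, f u with hF
  have hd : ∀ x, HasStrictDerivAt F (f x) x := fun x =>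
    ((hf.integral_hasStrictDerivAt 0 x)).const_add C
  have hmono : StrictMono F := strictMono_of_deriv_pos fun x => by
    rw [(hd x).hasDerivAt.deriv]; exact hpos x
  have hcont : Continuous F := continuous_iff_continuousAt.2 fun x => (hd x).hasDerivAt.continuousAt
  have htop : Filter.Tendsto F Filter.atTop (nhds 1) := by
    have := intervalIntegral_tendsto_integral_Ioi (μ := volume) (f := f) (0 : ℝ)
      hi.integrableOn Filter.tendsto_id
    have h2 := this.const_add C
    rw [hC, intervalIntegral.integral_Iic_add_Ioi hi.integrableOn hi.integrableOn, h1] at h2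
    exact h2
  have hbot : Filter.Tendsto F Filter.atBot (nhds 0) := by
    have := intervalIntegral_tendsto_integral_Iic (μ := volume) (f := f) (0 : ℝ)
      hi.integrableOn Filter.tendsto_id
    have h2 := this.const_sub C
    rw [← hC, sub_self] at h2
    refine h2.congr fun x => ?_
    simp only [hF, id]
    rw [intervalIntegral.integral_symm]; ring
  refine ⟨F, hd, hmono, Set.Subset.antisymm ?_ ?_⟩
  · rintro _ ⟨x, rfl⟩
    constructor
    · exact (hmono.monotone.le_of_tendsto hbot (x - 1)).trans_lt (hmono (by linarith))
    · exact (hmono (by linarith : x < x + 1)).trans_le (hmono.monotone.ge_of_tendsto htop (x + 1))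
  · intro y hy
    obtain ⟨a, ha⟩ := (hbot.eventually (gt_mem_nhds hy.1)).exists
    obtain ⟨b, hb⟩ := (htop.eventually (lt_mem_nhds hy.2)).exists
    exact mem_range_of_exists_le_of_exists_ge hcont ⟨a, ha.le⟩ ⟨b, hb.le⟩

/-- Monotone transport between continuous positive probability densities on the line. -/
theorem exists_monotone_transport {f g : ℝ → ℝ} (hf : Continuous f) (hfpos : ∀ x, 0 < f x)
    (hfi : Integrable f) (hf1 : ∫ x, f x = 1) (hg : Continuous g) (hgpos : ∀ x, 0 < g x)
    (hgi : Integrable g) (hg1 : ∫ x, g x = 1) :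
    ∃ T : ℝ → ℝ, StrictMono T ∧ ∀ x, HasDerivAt T (f x / g (T x)) x := by
  obtain ⟨F, hFd, hFm, hFr⟩ := exists_primitive_range_Ioo hf hfpos hfi hf1
  obtain ⟨G, hGd, hGm, hGr⟩ := exists_primitive_range_Ioo hg hgpos hgi hg1
  have hex : ∀ x, ∃ y, G y = F x := fun x => by
    have : F x ∈ Set.range G := by rw [hGr, ← hFr]; exact ⟨x, rfl⟩
    exact this
  choose T hT using hex
  have hTm : StrictMono T := fun x y hxy => by
    rw [← hGm.lt_iff_lt, hT, hT]; exact hFm hxy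
  have hTs : Function.Surjective T := fun y => by
    have : G y ∈ Set.range F := by rw [hFr, ← hGr]; exact ⟨y, rfl⟩
    obtain ⟨x, hx⟩ := this
    exact ⟨x, hGm.injective (by rw [hT, hx])⟩
  have hTc : Continuous T := hTm.monotone.continuous_of_surjective hTs
  refine ⟨T, hTm, fun x => ?_⟩
  -- Near `x`, `T` is the local inverse of `G` composed with `F`; continuity of `T` keeps it on the
  -- branch given by the inverse function theorem.
  have hne : g (T x) ≠ 0 := (hgpos _).ne'
  have hinv := (hGd (T x)).to_localInverse hne
  have hleft := (hGd (T x)).hasStrictFDerivAt_equiv hne |>.eventually_left_inverse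
  rw [hT] at hinv
  have hcomp := hinv.hasDerivAt.comp x (hFd x).hasDerivAt
  have hev := hTc.continuousAt.eventually hleft
  rw [div_eq_inv_mul]
  refine hcomp.congr_of_eventuallyEq ?_
  filter_upwards [hev] with y hy
  simp only [Function.comp]
  rw [← hT y]
  exact hy.symm

/-! ### Gaussian integrals and the two pointwise estimates -/

/-- The centred Gaussian density proportional to `exp (-π s x ^ 2)`. -/
noncomputable def gaussDensity (s x : ℝ) : ℝ := Real.exp (Real.log s / 2 - Real.pi * s * x ^ 2)

theorem gaussDensity_pos (s x : ℝ) : 0 < gaussDensity s x := Real.exp_pos _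

theorem continuous_gaussDensity (s : ℝ) : Continuous (gaussDensity s) := by
  unfold gaussDensity
  fun_prop

theorem exp_neg_log_div_two {s : ℝ} (hs : 0 < s) :
    Real.exp (-(Real.log s / 2)) = Real.sqrt (Real.pi / (Real.pi * s)) := by
  rw [div_mul_cancel_left₀ Real.pi_ne_zero, Real.sqrt_inv, Real.exp_neg, Real.sqrt_eq_rpow,
    Real.rpow_def_of_pos hs]
  congr 2
  ring

theorem integrable_gaussDensity {s : ℝ} (hs : 0 < s) : Integrable (gaussDensity s) := by
  have := (integrable_exp_neg_mul_sq (b := Real.pi * s) (by positivity)).const_mul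
    (Real.exp (Real.log s / 2))
  refine this.congr (Filter.Eventually.of_forall fun x => ?_)
  simp only [gaussDensity, ← Real.exp_add]
  ring_nf

theorem integral_gaussDensity {s : ℝ} (hs : 0 < s) : ∫ x, gaussDensity s x = 1 := by
  have h : gaussDensity s = fun x => Real.exp (Real.log s / 2) *
      Real.exp (-(Real.pi * s) * x ^ 2) := by
    ext x
    simp only [gaussDensity, ← Real.exp_add]
    ring_nf
  rw [h, integral_const_mul, integral_gaussian, ← exp_neg_log_div_two hs, ← Real.exp_add]
  simp

theorem lintegral_exp_neg_pi_mul_sq {s : ℝ} (hs : 0 < s) :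
    ∫⁻ x : ℝ, ENNReal.ofReal (Real.exp (-(Real.pi * s * x ^ 2))) =
      ENNReal.ofReal (Real.exp (-(Real.log s / 2))) := by
  have hi := integrable_exp_neg_mul_sq (b := Real.pi * s) (by positivity)
  rw [exp_neg_log_div_two hs, ← integral_gaussian, ofReal_integral_eq_lintegral_ofReal hi
    (Filter.Eventually.of_forall fun x => (Real.exp_pos _).le)]
  simp only [neg_mul]

theorem lintegral_exp_neg_pi_quadratic {a b : ℝ} (ha : 0 < a) (hb : 0 < b) (k : ℝ) :
    ∫⁻ z : ℝ × ℝ, ENNReal.ofReal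
        (Real.exp (-(Real.pi * (a * (z.1 - k * z.2) ^ 2 + b * z.2 ^ 2)))) =
      ENNReal.ofReal (Real.exp (-((Real.log a + Real.log b) / 2))) := by
  rw [Measure.volume_eq_prod, lintegral_prod_symm' _ (by fun_prop)]
  have inner : ∀ y : ℝ, ∫⁻ x : ℝ, ENNReal.ofReal
        (Real.exp (-(Real.pi * (a * (x - k * y) ^ 2 + b * y ^ 2)))) =
      ENNReal.ofReal (Real.exp (-(Real.log a / 2))) *
        ENNReal.ofReal (Real.exp (-(Real.pi * b * y ^ 2))) := by
    intro y
    rw [← lintegral_exp_neg_pi_mul_sq ha, ← lintegral_mul_const' _ _ ENNReal.ofReal_ne_top,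
      ← lintegral_sub_right_eq_self (fun x => ENNReal.ofReal (Real.exp (-(Real.pi * a * x ^ 2))) *
        ENNReal.ofReal (Real.exp (-(Real.pi * b * y ^ 2)))) (k * y)]
    refine lintegral_congr fun x => ?_
    rw [← ENNReal.ofReal_mul (Real.exp_pos _).le, ← Real.exp_add]
    ring_nf
  simp only [inner]
  rw [lintegral_const_mul' _ _ ENNReal.ofReal_ne_top, lintegral_exp_neg_pi_mul_sq hb,
    ← ENNReal.ofReal_mul (Real.exp_pos _).le, ← Real.exp_add]
  ring_nf

/-- Weighted AM-GM with weights `1 - cᵢ`, which sum to one. The right side is the Jacobian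
determinant of `transportMap` when the `lᵢ` are the derivatives of the three transports. -/
theorem youngExponent_mul_le {c₁ c₂ c₃ : ℝ} (h₁ : 0 < c₁) (h₂ : 0 < c₂) (h₃ : 0 < c₃)
    (h₁' : c₁ < 1) (h₂' : c₂ < 1) (h₃' : c₃ < 1) (hsum : c₁ + c₂ + c₃ = 2)
    {l₁ l₂ l₃ : ℝ} (hl₁ : 0 < l₁) (hl₂ : 0 < l₂) (hl₃ : 0 < l₃) :
    Real.exp (youngExponent c₁ + youngExponent c₂ + youngExponent c₃) *
        (l₁ ^ c₁ * l₂ ^ c₂ * l₃ ^ c₃) ≤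
      c₁ * c₂ * (l₁ * l₂) + c₁ * c₃ * (l₁ * l₃) + c₂ * c₃ * (l₂ * l₃) := by
  have w₁ : 0 < 1 - c₁ := by linarith
  have w₂ : 0 < 1 - c₂ := by linarith
  have w₃ : 0 < 1 - c₃ := by linarith
  have key := Real.geom_mean_le_arith_mean3_weighted w₁.le w₂.le w₃.le
    (p₁ := c₂ * c₃ * (l₂ * l₃) / (1 - c₁)) (p₂ := c₁ * c₃ * (l₁ * l₃) / (1 - c₂))
    (p₃ := c₁ * c₂ * (l₁ * l₂) / (1 - c₃)) (by positivity) (by positivity) (by positivity)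
    (by linarith)
  rw [mul_div_cancel₀ _ w₁.ne', mul_div_cancel₀ _ w₂.ne', mul_div_cancel₀ _ w₃.ne'] at key
  refine le_of_eq_of_le ?_ (key.trans_eq (by ring))
  have log_mul₄ : ∀ {u v m n : ℝ}, 0 < u → 0 < v → 0 < m → 0 < n →
      Real.log (u * v * (m * n)) = Real.log u + Real.log v + (Real.log m + Real.log n) := by
    intro u v m n hu hv hm hn
    rw [Real.log_mul (by positivity) (by positivity), Real.log_mul hu.ne' hv.ne',
      Real.log_mul hm.ne' hn.ne']
  rw [Real.rpow_def_of_pos hl₁, Real.rpow_def_of_pos hl₂, Real.rpow_def_of_pos hl₃,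
    Real.rpow_def_of_pos (by positivity), Real.rpow_def_of_pos (by positivity),
    Real.rpow_def_of_pos (by positivity)]
  simp only [← Real.exp_add]
  rw [Real.log_div (by positivity) w₁.ne', Real.log_div (by positivity) w₂.ne',
    Real.log_div (by positivity) w₃.ne', log_mul₄ h₂ h₃ hl₂ hl₃, log_mul₄ h₁ h₃ hl₁ hl₃,
    log_mul₄ h₁ h₂ hl₁ hl₂]
  have hc : c₃ = 2 - c₁ - c₂ := by linarith
  congr 1
  simp only [youngExponent]
  generalize Real.log c₁ = L1, Real.log c₂ = L2, Real.log c₃ = L3, Real.log (1 - c₁) = M1,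
    Real.log (1 - c₂) = M2, Real.log (1 - c₃) = M3
  rw [hc]
  ring

/-- With these variances the exponent is `∑ (1 - cᵢ) (cᵢ xᵢ)^2` up to `-π`. Minimising over `x₃` at
fixed `y₁, y₂` leaves the stated quadratic form, and the excess is a perfect square. -/
theorem prod_gaussDensity_rpow_le {c₁ c₂ c₃ : ℝ} (h₁ : 0 < c₁)
    (hsum : c₁ + c₂ + c₃ = 2) (x₁ x₂ x₃ : ℝ) {s₁ s₂ s₃ : ℝ} (hs₁ : s₁ = c₁ * (1 - c₁))
    (hs₂ : s₂ = c₂ * (1 - c₂)) (hs₃ : s₃ = c₃ * (1 - c₃)) {y₁ y₂ : ℝ}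
    (hy₁ : y₁ = c₁ * x₁ + c₃ * x₃) (hy₂ : y₂ = c₂ * x₂ + c₃ * x₃) :
    gaussDensity s₁ x₁ ^ c₁ * gaussDensity s₂ x₂ ^ c₂ * gaussDensity s₃ x₃ ^ c₃ ≤
      Real.exp ((c₁ * Real.log s₁ + c₂ * Real.log s₂ + c₃ * Real.log s₃) / 2) *
        Real.exp (-(Real.pi * ((1 - c₁) * c₁ * (y₁ - (1 - c₂) / c₁ * y₂) ^ 2 +
          (1 - c₂) * (1 - c₃) / c₁ * y₂ ^ 2))) := by
  simp only [gaussDensity, ← Real.exp_mul, ← Real.exp_add]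
  rw [Real.exp_le_exp]
  have hq : (1 - c₁) * c₁ * (y₁ - (1 - c₂) / c₁ * y₂) ^ 2 + (1 - c₂) * (1 - c₃) / c₁ * y₂ ^ 2 ≤
      c₁ * s₁ * x₁ ^ 2 + c₂ * s₂ * x₂ ^ 2 + c₃ * s₃ * x₃ ^ 2 := by
    have e : c₁ * s₁ * x₁ ^ 2 + c₂ * s₂ * x₂ ^ 2 + c₃ * s₃ * x₃ ^ 2 -
        ((1 - c₁) * c₁ * (y₁ - (1 - c₂) / c₁ * y₂) ^ 2 + (1 - c₂) * (1 - c₃) / c₁ * y₂ ^ 2) =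
        ((1 - c₁) * y₁ + (1 - c₂) * y₂ - c₃ * x₃) ^ 2 := by
      have hc : c₃ = 2 - c₁ - c₂ := by linarith
      rw [hs₁, hs₂, hs₃, hy₁, hy₂, hc]
      field_simp
      ring
    nlinarith [sq_nonneg ((1 - c₁) * y₁ + (1 - c₂) * y₂ - c₃ * x₃)]
  have := mul_le_mul_of_nonneg_left hq Real.pi_pos.le
  nlinarith

/-! ### Sharp Young inequality on the line by change of variables -/

/-- The map `(x, y) ↦ (c₁ T₁ x + c₃ T₃ (x + y), c₂ T₂ y + c₃ T₃ (x + y))`. -/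
def transportMap (c₁ c₂ c₃ : ℝ) (T₁ T₂ T₃ : ℝ → ℝ) (z : ℝ × ℝ) : ℝ × ℝ :=
  (c₁ * T₁ z.1 + c₃ * T₃ (z.1 + z.2), c₂ * T₂ z.2 + c₃ * T₃ (z.1 + z.2))

/-- The map is strictly monotone: its increment paired with `z - z'` is a sum of three nonnegative
terms, one per transport. -/
theorem transportMap_injective {c₁ c₂ c₃ : ℝ} (h₁ : 0 < c₁) (h₂ : 0 < c₂) (h₃ : 0 < c₃)
    {T₁ T₂ T₃ : ℝ → ℝ} (hT₁ : StrictMono T₁) (hT₂ : StrictMono T₂) (hT₃ : StrictMono T₃) :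
    Function.Injective (transportMap c₁ c₂ c₃ T₁ T₂ T₃) := by
  rintro ⟨x, y⟩ ⟨x', y'⟩ h
  simp only [transportMap, Prod.mk.injEq] at h
  obtain ⟨e₁, e₂⟩ := h
  have mono : ∀ {T : ℝ → ℝ}, StrictMono T → ∀ a b, 0 ≤ (T a - T b) * (a - b) := by
    intro T hT a b
    rcases le_total a b with hab | hab
    · exact mul_nonneg_of_nonpos_of_nonpos (sub_nonpos.2 (hT.monotone hab)) (sub_nonpos.2 hab)
    · exact mul_nonneg (sub_nonneg.2 (hT.monotone hab)) (sub_nonneg.2 hab)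
  have m₁ := mul_nonneg h₁.le (mono hT₁ x x')
  have m₂ := mul_nonneg h₂.le (mono hT₂ y y')
  have m₃ := mul_nonneg h₃.le (mono hT₃ (x + y) (x' + y'))
  have hs : c₁ * ((T₁ x - T₁ x') * (x - x')) + c₂ * ((T₂ y - T₂ y') * (y - y')) +
      c₃ * ((T₃ (x + y) - T₃ (x' + y')) * (x + y - (x' + y'))) = 0 := by
    linear_combination (x - x') * e₁ + (y - y') * e₂
  have z₁ : (T₁ x - T₁ x') * (x - x') = 0 := by
    rcases mul_eq_zero.1 (by linarith : c₁ * ((T₁ x - T₁ x') * (x - x')) = 0) with h | h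
    · exact absurd h h₁.ne'
    · exact h
  have z₂ : (T₂ y - T₂ y') * (y - y') = 0 := by
    rcases mul_eq_zero.1 (by linarith : c₂ * ((T₂ y - T₂ y') * (y - y')) = 0) with h | h
    · exact absurd h h₂.ne'
    · exact h
  have fin : ∀ {T : ℝ → ℝ}, StrictMono T → ∀ a b, (T a - T b) * (a - b) = 0 → a = b := by
    intro T hT a b h
    rcases mul_eq_zero.1 h with h | h
    · exact hT.injective (sub_eq_zero.1 h)
    · exact sub_eq_zero.1 h
  rw [fin hT₁ _ _ z₁, fin hT₂ _ _ z₂]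

/-- The derivative of `transportMap` in terms of the derivatives of the components. -/
noncomputable def transportMapDeriv (a b e : ℝ) : ℝ × ℝ →L[ℝ] ℝ × ℝ :=
  (Matrix.toLin (.finTwoProd ℝ) (.finTwoProd ℝ)
    !![a + e, e; e, b + e]).toContinuousLinearMap

theorem det_transportMapDeriv (a b e : ℝ) :
    (transportMapDeriv a b e).det = a * b + a * e + b * e := by
  conv_lhs => rw [transportMapDeriv, LinearMap.det_toContinuousLinearMap, LinearMap.det_toLin,
    Matrix.det_fin_two_of]
  ring

theorem hasFDerivAt_transportMap {c₁ c₂ c₃ : ℝ} {T₁ T₂ T₃ : ℝ → ℝ} {a b e : ℝ} {z : ℝ × ℝ}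
    (h₁ : HasDerivAt T₁ a z.1) (h₂ : HasDerivAt T₂ b z.2) (h₃ : HasDerivAt T₃ e (z.1 + z.2)) :
    HasFDerivAt (transportMap c₁ c₂ c₃ T₁ T₂ T₃)
      (transportMapDeriv (c₁ * a) (c₂ * b) (c₃ * e)) z := by
  unfold transportMapDeriv
  rw [Matrix.toLin_finTwoProd_toContinuousLinearMap]
  have d₁ := (h₁.comp_hasFDerivAt z (hasFDerivAt_fst (𝕜 := ℝ) (p := z))).const_mul c₁
  have d₂ := (h₂.comp_hasFDerivAt z (hasFDerivAt_snd (𝕜 := ℝ) (p := z))).const_mul c₂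
  have d₃ := (h₃.comp_hasFDerivAt z ((hasFDerivAt_fst (𝕜 := ℝ) (p := z)).add
    (hasFDerivAt_snd (𝕜 := ℝ) (p := z)))).const_mul c₃
  have d := (d₁.add d₃).prodMk (d₂.add d₃)
  refine d.congr_fderiv ?_
  ext <;> simp

/-- Sharp trilinear Young inequality on the line for continuous positive densities. -/
theorem young_trilinear_of_continuous_pos {c₁ c₂ c₃ : ℝ} (h₁ : 0 < c₁) (h₂ : 0 < c₂)
    (h₃ : 0 < c₃) (h₁' : c₁ < 1) (h₂' : c₂ < 1) (h₃' : c₃ < 1) (hsum : c₁ + c₂ + c₃ = 2)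
    {f₁ f₂ f₃ : ℝ → ℝ} (hf₁ : Continuous f₁) (hf₂ : Continuous f₂) (hf₃ : Continuous f₃)
    (hp₁ : ∀ x, 0 < f₁ x) (hp₂ : ∀ x, 0 < f₂ x) (hp₃ : ∀ x, 0 < f₃ x)
    (hi₁ : Integrable f₁) (hi₂ : Integrable f₂) (hi₃ : Integrable f₃)
    (ho₁ : ∫ x, f₁ x = 1) (ho₂ : ∫ x, f₂ x = 1) (ho₃ : ∫ x, f₃ x = 1) :
    ∫⁻ z : ℝ × ℝ, ENNReal.ofReal (f₁ z.1 ^ c₁ * f₂ z.2 ^ c₂ * f₃ (z.1 + z.2) ^ c₃) ≤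
      ENNReal.ofReal
        (Real.exp (-((youngExponent c₁ + youngExponent c₂ + youngExponent c₃) / 2))) := by
  have w₁ : 0 < 1 - c₁ := by linarith
  have w₂ : 0 < 1 - c₂ := by linarith
  have w₃ : 0 < 1 - c₃ := by linarith
  obtain ⟨s₁, hs₁⟩ : ∃ s, s = c₁ * (1 - c₁) := ⟨_, rfl⟩
  obtain ⟨s₂, hs₂⟩ : ∃ s, s = c₂ * (1 - c₂) := ⟨_, rfl⟩
  obtain ⟨s₃, hs₃⟩ : ∃ s, s = c₃ * (1 - c₃) := ⟨_, rfl⟩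
  have hs₁p : 0 < s₁ := by rw [hs₁]; positivity
  have hs₂p : 0 < s₂ := by rw [hs₂]; positivity
  have hs₃p : 0 < s₃ := by rw [hs₃]; positivity
  obtain ⟨T₁, hm₁, hd₁⟩ := exists_monotone_transport hf₁ hp₁ hi₁ ho₁ (continuous_gaussDensity s₁)
    (gaussDensity_pos s₁) (integrable_gaussDensity hs₁p) (integral_gaussDensity hs₁p)
  obtain ⟨T₂, hm₂, hd₂⟩ := exists_monotone_transport hf₂ hp₂ hi₂ ho₂ (continuous_gaussDensity s₂)
    (gaussDensity_pos s₂) (integrable_gaussDensity hs₂p) (integral_gaussDensity hs₂p)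
  obtain ⟨T₃, hm₃, hd₃⟩ := exists_monotone_transport hf₃ hp₃ hi₃ ho₃ (continuous_gaussDensity s₃)
    (gaussDensity_pos s₃) (integrable_gaussDensity hs₃p) (integral_gaussDensity hs₃p)
  set Ψ := youngExponent c₁ + youngExponent c₂ + youngExponent c₃ with hΨ
  set S := (c₁ * Real.log s₁ + c₂ * Real.log s₂ + c₃ * Real.log s₃) / 2 with hS
  set a : ℝ × ℝ → ℝ := fun z => f₁ z.1 / gaussDensity s₁ (T₁ z.1) with ha
  set b : ℝ × ℝ → ℝ := fun z => f₂ z.2 / gaussDensity s₂ (T₂ z.2) with hb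
  set e : ℝ × ℝ → ℝ := fun z => f₃ (z.1 + z.2) / gaussDensity s₃ (T₃ (z.1 + z.2)) with he
  set Φ := transportMap c₁ c₂ c₃ T₁ T₂ T₃ with hΦ
  set G : ℝ × ℝ → ℝ := fun y => Real.exp (-(Real.pi * ((1 - c₁) * c₁ *
    (y.1 - (1 - c₂) / c₁ * y.2) ^ 2 + (1 - c₂) * (1 - c₃) / c₁ * y.2 ^ 2))) with hG
  have pointwise : ∀ z : ℝ × ℝ,
      ENNReal.ofReal (f₁ z.1 ^ c₁ * f₂ z.2 ^ c₂ * f₃ (z.1 + z.2) ^ c₃) ≤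
      ENNReal.ofReal (Real.exp (S - Ψ)) *
        (ENNReal.ofReal |(transportMapDeriv (c₁ * a z) (c₂ * b z) (c₃ * e z)).det| *
          ENNReal.ofReal (G (Φ z))) := by
    intro z
    have pa : 0 < a z := div_pos (hp₁ _) (gaussDensity_pos _ _)
    have pb : 0 < b z := div_pos (hp₂ _) (gaussDensity_pos _ _)
    have pe : 0 < e z := div_pos (hp₃ _) (gaussDensity_pos _ _)
    rw [← ENNReal.ofReal_mul (abs_nonneg _), ← ENNReal.ofReal_mul (Real.exp_pos _).le,
      det_transportMapDeriv, abs_of_pos (by positivity)]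
    refine ENNReal.ofReal_le_ofReal ?_
    have r₁ : f₁ z.1 = a z * gaussDensity s₁ (T₁ z.1) :=
      (div_mul_cancel₀ _ (gaussDensity_pos _ _).ne').symm
    have r₂ : f₂ z.2 = b z * gaussDensity s₂ (T₂ z.2) :=
      (div_mul_cancel₀ _ (gaussDensity_pos _ _).ne').symm
    have r₃ : f₃ (z.1 + z.2) = e z * gaussDensity s₃ (T₃ (z.1 + z.2)) :=
      (div_mul_cancel₀ _ (gaussDensity_pos _ _).ne').symm
    have g₁ := gaussDensity_pos s₁ (T₁ z.1)
    have g₂ := gaussDensity_pos s₂ (T₂ z.2)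
    have g₃ := gaussDensity_pos s₃ (T₃ (z.1 + z.2))
    rw [r₁, r₂, r₃, Real.mul_rpow pa.le (gaussDensity_pos _ _).le,
      Real.mul_rpow pb.le (gaussDensity_pos _ _).le, Real.mul_rpow pe.le (gaussDensity_pos _ _).le]
    have k1 := youngExponent_mul_le h₁ h₂ h₃ h₁' h₂' h₃' hsum pa pb pe
    have k2 := prod_gaussDensity_rpow_le h₁ hsum (T₁ z.1) (T₂ z.2) (T₃ (z.1 + z.2))
      hs₁ hs₂ hs₃ (y₁ := (Φ z).1) (y₂ := (Φ z).2) rfl rfl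
    rw [← hΨ] at k1
    have k3 : a z ^ c₁ * b z ^ c₂ * e z ^ c₃ ≤ Real.exp (-Ψ) *
        (c₁ * c₂ * (a z * b z) + c₁ * c₃ * (a z * e z) + c₂ * c₃ * (b z * e z)) := by
      refine le_of_eq_of_le ?_ (mul_le_mul_of_nonneg_left k1 (Real.exp_pos _).le)
      rw [← mul_assoc, ← Real.exp_add, neg_add_cancel, Real.exp_zero, one_mul]
    have k4 := mul_le_mul k3 k2 (by positivity) (by positivity)
    refine le_of_eq_of_le (by ring) (k4.trans_eq ?_)
    rw [sub_eq_add_neg S Ψ, Real.exp_add]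
    ring
  have cov := lintegral_image_eq_lintegral_abs_det_fderiv_mul volume (f := Φ)
    (f' := fun z => transportMapDeriv (c₁ * a z) (c₂ * b z) (c₃ * e z)) MeasurableSet.univ
    (fun z _ => (hasFDerivAt_transportMap (hd₁ _) (hd₂ _) (hd₃ _)).hasFDerivWithinAt)
    (transportMap_injective h₁ h₂ h₃ hm₁ hm₂ hm₃).injOn (fun y => ENNReal.ofReal (G y))
  rw [setLIntegral_univ] at cov
  calc _ ≤ _ := lintegral_mono pointwise
    _ = ENNReal.ofReal (Real.exp (S - Ψ)) *
        ∫⁻ y in Φ '' Set.univ, ENNReal.ofReal (G y) := by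
      rw [lintegral_const_mul' _ _ ENNReal.ofReal_ne_top, cov]
    _ ≤ ENNReal.ofReal (Real.exp (S - Ψ)) * ∫⁻ y, ENNReal.ofReal (G y) := by
      gcongr
      exact Measure.restrict_le_self
    _ = _ := by
      rw [lintegral_exp_neg_pi_quadratic (by positivity) (by positivity),
        ← ENNReal.ofReal_mul (Real.exp_pos _).le, ← Real.exp_add]
      congr 2
      -- The quadratic form has determinant `∏ (1 - cᵢ)`; `S` minus half its logarithm equals `Ψ /
      -- 2`, so the total exponent is `-Ψ / 2`.
      rw [hS, hΨ, hs₁, hs₂, hs₃, Real.log_mul h₁.ne' w₁.ne', Real.log_mul h₂.ne' w₂.ne',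
        Real.log_mul h₃.ne' w₃.ne', Real.log_mul w₁.ne' h₁.ne',
        Real.log_div (by positivity) h₁.ne', Real.log_mul w₂.ne' w₃.ne']
      simp only [youngExponent]
      ring

/-- Both sides are homogeneous of degree `cᵢ` in `fᵢ`, so dividing by the masses reduces to
densities. -/
theorem young_trilinear_of_continuous {c₁ c₂ c₃ : ℝ} (h₁ : 0 < c₁) (h₂ : 0 < c₂)
    (h₃ : 0 < c₃) (h₁' : c₁ < 1) (h₂' : c₂ < 1) (h₃' : c₃ < 1) (hsum : c₁ + c₂ + c₃ = 2)
    {f₁ f₂ f₃ : ℝ → ℝ} (hf₁ : Continuous f₁) (hf₂ : Continuous f₂) (hf₃ : Continuous f₃)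
    (hp₁ : ∀ x, 0 < f₁ x) (hp₂ : ∀ x, 0 < f₂ x) (hp₃ : ∀ x, 0 < f₃ x)
    (hi₁ : Integrable f₁) (hi₂ : Integrable f₂) (hi₃ : Integrable f₃) :
    ∫⁻ z : ℝ × ℝ, ENNReal.ofReal (f₁ z.1) ^ c₁ * ENNReal.ofReal (f₂ z.2) ^ c₂ *
        ENNReal.ofReal (f₃ (z.1 + z.2)) ^ c₃ ≤
      ENNReal.ofReal
        (Real.exp (-((youngExponent c₁ + youngExponent c₂ + youngExponent c₃) / 2))) *
        ((∫⁻ x, ENNReal.ofReal (f₁ x)) ^ c₁ * (∫⁻ x, ENNReal.ofReal (f₂ x)) ^ c₂ *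
          (∫⁻ x, ENNReal.ofReal (f₃ x)) ^ c₃) := by
  have intpos : ∀ {f : ℝ → ℝ}, (∀ x, 0 < f x) → Integrable f → 0 < ∫ x, f x := by
    intro f hp hi
    rw [integral_pos_iff_support_of_nonneg (fun x => (hp x).le) hi,
      Function.support_eq_univ fun x => (hp x).ne']
    simp
  have m₁ := intpos hp₁ hi₁
  have m₂ := intpos hp₂ hi₂
  have m₃ := intpos hp₃ hi₃
  rw [← ofReal_integral_eq_lintegral_ofReal hi₁ (Filter.Eventually.of_forall fun x => (hp₁ x).le),
    ← ofReal_integral_eq_lintegral_ofReal hi₂ (Filter.Eventually.of_forall fun x => (hp₂ x).le),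
    ← ofReal_integral_eq_lintegral_ofReal hi₃ (Filter.Eventually.of_forall fun x => (hp₃ x).le)]
  set I₁ := ∫ x, f₁ x
  set I₂ := ∫ x, f₂ x
  set I₃ := ∫ x, f₃ x
  have key := young_trilinear_of_continuous_pos h₁ h₂ h₃ h₁' h₂' h₃' hsum
    (hf₁.div_const I₁) (hf₂.div_const I₂) (hf₃.div_const I₃)
    (fun x => div_pos (hp₁ x) m₁) (fun x => div_pos (hp₂ x) m₂) (fun x => div_pos (hp₃ x) m₃)
    (hi₁.div_const I₁) (hi₂.div_const I₂) (hi₃.div_const I₃)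
    (by rw [integral_div]; exact div_self m₁.ne') (by rw [integral_div]; exact div_self m₂.ne')
    (by rw [integral_div]; exact div_self m₃.ne')
  have hpt : ∀ z : ℝ × ℝ, ENNReal.ofReal (f₁ z.1) ^ c₁ * ENNReal.ofReal (f₂ z.2) ^ c₂ *
        ENNReal.ofReal (f₃ (z.1 + z.2)) ^ c₃ =
      ENNReal.ofReal ((f₁ z.1 / I₁) ^ c₁ * (f₂ z.2 / I₂) ^ c₂ * (f₃ (z.1 + z.2) / I₃) ^ c₃) *
        (ENNReal.ofReal I₁ ^ c₁ * ENNReal.ofReal I₂ ^ c₂ * ENNReal.ofReal I₃ ^ c₃) := by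
    intro z
    have e₁ := hp₁ z.1
    have e₂ := hp₂ z.2
    have e₃ := hp₃ (z.1 + z.2)
    rw [ENNReal.ofReal_rpow_of_pos e₁, ENNReal.ofReal_rpow_of_pos e₂, ENNReal.ofReal_rpow_of_pos e₃,
      ENNReal.ofReal_rpow_of_pos m₁, ENNReal.ofReal_rpow_of_pos m₂, ENNReal.ofReal_rpow_of_pos m₃,
      ← ENNReal.ofReal_mul (by positivity), ← ENNReal.ofReal_mul (by positivity),
      ← ENNReal.ofReal_mul (by positivity), ← ENNReal.ofReal_mul (by positivity),
      ← ENNReal.ofReal_mul (by positivity), Real.div_rpow e₁.le m₁.le, Real.div_rpow e₂.le m₂.le,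
      Real.div_rpow e₃.le m₃.le]
    congr 1
    have := (Real.rpow_pos_of_pos m₁ c₁).ne'
    have := (Real.rpow_pos_of_pos m₂ c₂).ne'
    have := (Real.rpow_pos_of_pos m₃ c₃).ne'
    field_simp
  simp only [hpt]
  rw [lintegral_mul_const' _ _ (by finiteness)]
  exact mul_le_mul_left key _

/-! ### From continuous to measurable functions -/

/-- Approximation of a finite-mass measurable function by positive continuous ones. -/
theorem exists_continuous_pos_approx {f : ℝ → ENNReal} (hf : Measurable f)
    (hfin : ∫⁻ x, f x ≠ ⊤) :
    ∃ φ : ℕ → ℝ → ℝ, (∀ n, Continuous (φ n)) ∧ (∀ n x, 0 < φ n x) ∧ (∀ n, Integrable (φ n)) ∧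
      (∀ᵐ x, Filter.Tendsto (fun n => ENNReal.ofReal (φ n x)) Filter.atTop (nhds (f x))) ∧
      ∃ δ : ℕ → ENNReal, Filter.Tendsto δ Filter.atTop (nhds 0) ∧
        ∀ n, ∫⁻ x, ENNReal.ofReal (φ n x) ≤ (∫⁻ x, f x) + δ n := by
  have hF : Integrable (fun x => (f x).toReal) := integrable_toReal_of_lintegral_ne_top
    hf.aemeasurable hfin
  have hε : ∀ n : ℕ, ((n : ENNReal) + 1)⁻¹ ≠ 0 := fun n => by
    rw [ENNReal.inv_ne_zero]; finiteness
  have hε0 : Filter.Tendsto (fun n : ℕ => ((n : ENNReal) + 1)⁻¹) Filter.atTop (nhds 0) := by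
    have := ENNReal.tendsto_inv_nat_nhds_zero.comp (Filter.tendsto_add_atTop_nat 1)
    refine this.congr fun n => ?_
    simp
  choose g _ hg hgc hgi using fun n : ℕ => hF.exists_hasCompactSupport_lintegral_sub_le (hε n)
  have hmeas : TendstoInMeasure volume g Filter.atTop (fun x => (f x).toReal) := by
    refine tendstoInMeasure_of_tendsto_eLpNorm one_ne_zero
      (fun n => (hgc n).aestronglyMeasurable) hF.aestronglyMeasurable ?_
    refine tendsto_of_tendsto_of_tendsto_of_le_of_le tendsto_const_nhds hε0 (fun _ => zero_le)
      fun n => ?_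
    rw [eLpNorm_one_eq_lintegral_enorm]
    refine le_of_eq_of_le (lintegral_congr fun x => ?_) (hg n)
    rw [Pi.sub_apply, enorm_sub_rev]
  obtain ⟨ns, hns, hae⟩ := hmeas.exists_seq_tendsto_ae
  have hr0 : Filter.Tendsto (fun n : ℕ => 1 / ((n : ℝ) + 1)) Filter.atTop (nhds 0) :=
    tendsto_one_div_add_atTop_nhds_zero_nat
  -- A vanishing multiple of a Gaussian makes the approximants strictly positive. An upper bound on
  -- their masses is enough, since the limit is taken with Fatou.
  refine ⟨fun n x => |g (ns n) x| + 1 / ((n : ℝ) + 1) * gaussDensity 1 x, fun n => ?_, fun n x => ?_,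
    fun n => ?_, ?_, fun n => ((ns n : ENNReal) + 1)⁻¹ + ENNReal.ofReal (1 / ((n : ℝ) + 1)), ?_,
    fun n => ?_⟩
  · exact (hgc _).abs.add (continuous_const.mul (continuous_gaussDensity 1))
  · have := gaussDensity_pos 1 x
    positivity
  · exact (hgi _).abs.add ((integrable_gaussDensity one_pos).const_mul _)
  · filter_upwards [hae, ae_lt_top hf hfin] with x hx hxt
    have h2 := hx.abs.add (hr0.mul_const (gaussDensity 1 x))
    rw [abs_of_nonneg ENNReal.toReal_nonneg, zero_mul, add_zero] at h2
    have h3 := ENNReal.tendsto_ofReal h2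
    rwa [ENNReal.ofReal_toReal hxt.ne] at h3
  · have h1 := (hε0.comp hns.tendsto_atTop).add (ENNReal.tendsto_ofReal hr0)
    simpa using h1
  · have e1 : ∀ x, ENNReal.ofReal (|g (ns n) x| + 1 / ((n : ℝ) + 1) * gaussDensity 1 x) ≤
        f x + ‖(f x).toReal - g (ns n) x‖ₑ +
          ENNReal.ofReal (1 / ((n : ℝ) + 1)) * ENNReal.ofReal (gaussDensity 1 x) := by
      intro x
      rw [ENNReal.ofReal_add (abs_nonneg _) (by have := gaussDensity_pos 1 x; positivity),
        ENNReal.ofReal_mul (by positivity)]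
      gcongr
      rw [← Real.enorm_eq_ofReal_abs]
      calc ‖g (ns n) x‖ₑ = ‖(f x).toReal - ((f x).toReal - g (ns n) x)‖ₑ := by
            rw [sub_sub_cancel]
        _ ≤ ‖(f x).toReal‖ₑ + ‖(f x).toReal - g (ns n) x‖ₑ := enorm_sub_le
        _ ≤ _ := by
          gcongr
          rw [Real.enorm_of_nonneg ENNReal.toReal_nonneg]
          exact ENNReal.ofReal_toReal_le
    refine (lintegral_mono e1).trans ?_
    have hgm : Measurable (g (ns n)) := (hgc _).measurable
    have hgd : Measurable (gaussDensity 1) := (continuous_gaussDensity 1).measurable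
    rw [lintegral_add_left (by fun_prop), lintegral_add_left hf,
      lintegral_const_mul' _ _ ENNReal.ofReal_ne_top,
      ← ofReal_integral_eq_lintegral_ofReal (integrable_gaussDensity one_pos)
        (Filter.Eventually.of_forall fun x => (gaussDensity_pos 1 x).le),
      integral_gaussDensity one_pos, ENNReal.ofReal_one, mul_one, add_assoc]
    exact add_le_add_right (add_le_add_left (hg _) _) _

/-- The trilinear form of Young's convolution inequality on `E`, with constant `K`. -/
def TrilinearYoung (E : Type*) [MeasureSpace E] [Add E] (c₁ c₂ c₃ : ℝ) (K : ENNReal) : Prop :=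
  ∀ f g h : E → ENNReal, Measurable f → Measurable g → Measurable h →
    ∫⁻ x, ∫⁻ y, f x ^ c₁ * g y ^ c₂ * h (x + y) ^ c₃ ≤
      K * ((∫⁻ x, f x) ^ c₁ * (∫⁻ x, g x) ^ c₂ * (∫⁻ x, h x) ^ c₃)

/-- The sharp constant in the one-dimensional Young inequality. -/
noncomputable def youngConst (c₁ c₂ c₃ : ℝ) : ENNReal :=
  ENNReal.ofReal (Real.exp (-((youngExponent c₁ + youngExponent c₂ + youngExponent c₃) / 2)))

theorem young_trilinear_of_lintegral_ne_top {c₁ c₂ c₃ : ℝ} (h₁ : 0 < c₁) (h₂ : 0 < c₂)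
    (h₃ : 0 < c₃) (h₁' : c₁ < 1) (h₂' : c₂ < 1) (h₃' : c₃ < 1) (hsum : c₁ + c₂ + c₃ = 2)
    {f g h : ℝ → ENNReal} (hf : Measurable f) (hg : Measurable g) (hh : Measurable h)
    (hft : ∫⁻ x, f x ≠ ⊤) (hgt : ∫⁻ x, g x ≠ ⊤) (hht : ∫⁻ x, h x ≠ ⊤) :
    ∫⁻ x, ∫⁻ y, f x ^ c₁ * g y ^ c₂ * h (x + y) ^ c₃ ≤
      youngConst c₁ c₂ c₃ * ((∫⁻ x, f x) ^ c₁ * (∫⁻ x, g x) ^ c₂ * (∫⁻ x, h x) ^ c₃) := by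
  obtain ⟨φ, hφc, hφp, hφi, hφa, δ, hδ, hφδ⟩ := exists_continuous_pos_approx hf hft
  obtain ⟨ψ, hψc, hψp, hψi, hψa, η, hη, hψη⟩ := exists_continuous_pos_approx hg hgt
  obtain ⟨χ, hχc, hχp, hχi, hχa, κ, hκ, hχκ⟩ := exists_continuous_pos_approx hh hht
  rw [← lintegral_prod (fun z : ℝ × ℝ => f z.1 ^ c₁ * g z.2 ^ c₂ * h (z.1 + z.2) ^ c₃)
    (by fun_prop), ← Measure.volume_eq_prod]
  -- Null sets must pull back to null sets under addition for a.e. convergence to hold at `z.1 +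
  -- z.2`.
  have hsumq : Measure.QuasiMeasurePreserving (fun z : ℝ × ℝ => z.1 + z.2) volume volume := by
    rw [Measure.volume_eq_prod]
    exact Measure.quasiMeasurePreserving_snd.comp
      (measurePreserving_prod_add (volume : Measure ℝ) volume).quasiMeasurePreserving
  have hae : ∀ᵐ z : ℝ × ℝ, Filter.Tendsto (fun n => ENNReal.ofReal (φ n z.1) ^ c₁ *
      ENNReal.ofReal (ψ n z.2) ^ c₂ * ENNReal.ofReal (χ n (z.1 + z.2)) ^ c₃) Filter.atTop
      (nhds (f z.1 ^ c₁ * g z.2 ^ c₂ * h (z.1 + z.2) ^ c₃)) := by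
    have q1 : Measure.QuasiMeasurePreserving (Prod.fst : ℝ × ℝ → ℝ) volume volume :=
      Measure.quasiMeasurePreserving_fst
    have q2 : Measure.QuasiMeasurePreserving (Prod.snd : ℝ × ℝ → ℝ) volume volume :=
      Measure.quasiMeasurePreserving_snd
    filter_upwards [q1.ae hφa, q2.ae hψa, hsumq.ae hχa,
      q1.ae (ae_lt_top hf hft), q2.ae (ae_lt_top hg hgt), hsumq.ae (ae_lt_top hh hht)]
      with z a1 a2 a3 b1 b2 b3
    have a1' := a1.ennrpow_const c₁
    have a2' := a2.ennrpow_const c₂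
    have a3' := a3.ennrpow_const c₃
    have n1 : f z.1 ^ c₁ ≠ ⊤ := ENNReal.rpow_ne_top_of_nonneg h₁.le b1.ne
    have n2 : g z.2 ^ c₂ ≠ ⊤ := ENNReal.rpow_ne_top_of_nonneg h₂.le b2.ne
    have n3 : h (z.1 + z.2) ^ c₃ ≠ ⊤ := ENNReal.rpow_ne_top_of_nonneg h₃.le b3.ne
    exact ENNReal.Tendsto.mul (ENNReal.Tendsto.mul a1' (Or.inr n2) a2' (Or.inr n1))
      (Or.inr n3) a3' (Or.inr (ENNReal.mul_ne_top n1 n2))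
  have lim : Filter.Tendsto (fun n => youngConst c₁ c₂ c₃ * (((∫⁻ x, f x) + δ n) ^ c₁ *
      ((∫⁻ x, g x) + η n) ^ c₂ * ((∫⁻ x, h x) + κ n) ^ c₃)) Filter.atTop
      (nhds (youngConst c₁ c₂ c₃ *
        ((∫⁻ x, f x) ^ c₁ * (∫⁻ x, g x) ^ c₂ * (∫⁻ x, h x) ^ c₃))) := by
    have a1 := (hδ.const_add (∫⁻ x, f x)).ennrpow_const c₁
    have a2 := (hη.const_add (∫⁻ x, g x)).ennrpow_const c₂
    have a3 := (hκ.const_add (∫⁻ x, h x)).ennrpow_const c₃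
    rw [add_zero] at a1 a2 a3
    have n1 : (∫⁻ x, f x) ^ c₁ ≠ ⊤ := ENNReal.rpow_ne_top_of_nonneg h₁.le hft
    have n2 : (∫⁻ x, g x) ^ c₂ ≠ ⊤ := ENNReal.rpow_ne_top_of_nonneg h₂.le hgt
    have n3 : (∫⁻ x, h x) ^ c₃ ≠ ⊤ := ENNReal.rpow_ne_top_of_nonneg h₃.le hht
    exact ENNReal.Tendsto.const_mul (ENNReal.Tendsto.mul (ENNReal.Tendsto.mul a1 (Or.inr n2) a2
      (Or.inr n1)) (Or.inr n3) a3 (Or.inr (ENNReal.mul_ne_top n1 n2)))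
      (Or.inr ENNReal.ofReal_ne_top)
  have mφ := fun n => (hφc n).measurable
  have mψ := fun n => (hψc n).measurable
  have mχ := fun n => (hχc n).measurable
  calc ∫⁻ z : ℝ × ℝ, f z.1 ^ c₁ * g z.2 ^ c₂ * h (z.1 + z.2) ^ c₃
      = ∫⁻ z : ℝ × ℝ, Filter.liminf (fun n => ENNReal.ofReal (φ n z.1) ^ c₁ *
          ENNReal.ofReal (ψ n z.2) ^ c₂ * ENNReal.ofReal (χ n (z.1 + z.2)) ^ c₃) Filter.atTop :=
        lintegral_congr_ae (hae.mono fun z hz => hz.liminf_eq.symm)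
    _ ≤ Filter.liminf (fun n => ∫⁻ z : ℝ × ℝ, ENNReal.ofReal (φ n z.1) ^ c₁ *
          ENNReal.ofReal (ψ n z.2) ^ c₂ * ENNReal.ofReal (χ n (z.1 + z.2)) ^ c₃) Filter.atTop :=
        lintegral_liminf_le fun n => by fun_prop
    _ ≤ Filter.liminf (fun n => youngConst c₁ c₂ c₃ * (((∫⁻ x, f x) + δ n) ^ c₁ *
      ((∫⁻ x, g x) + η n) ^ c₂ * ((∫⁻ x, h x) + κ n) ^ c₃)) Filter.atTop := by
        refine Filter.liminf_le_liminf (Filter.Eventually.of_forall fun n => ?_)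
        refine (young_trilinear_of_continuous h₁ h₂ h₃ h₁' h₂' h₃' hsum (hφc n) (hψc n) (hχc n)
          (hφp n) (hψp n) (hχp n) (hφi n) (hψi n) (hχi n)).trans ?_
        unfold youngConst
        gcongr
        · exact hφδ n
        · exact hψη n
        · exact hχκ n
    _ = _ := lim.liminf_eq

theorem trilinearYoung_real {c₁ c₂ c₃ : ℝ} (h₁ : 0 < c₁) (h₂ : 0 < c₂)
    (h₃ : 0 < c₃) (h₁' : c₁ < 1) (h₂' : c₂ < 1) (h₃' : c₃ < 1) (hsum : c₁ + c₂ + c₃ = 2) :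
    TrilinearYoung ℝ c₁ c₂ c₃ (youngConst c₁ c₂ c₃) := by
  intro f g h hf hg hh
  -- Zero masses are settled first, so that an infinite mass later makes the right side `⊤` rather
  -- than `0 * ⊤ = 0`.
  by_cases hf0 : ∫⁻ x, f x = 0
  · rw [lintegral_eq_zero_iff hf] at hf0
    refine le_of_eq_of_le ?_ zero_le
    rw [lintegral_congr_ae (g := fun _ => 0), lintegral_zero]
    filter_upwards [hf0] with x hx
    simp [hx, h₁]
  by_cases hg0 : ∫⁻ x, g x = 0
  · rw [lintegral_eq_zero_iff hg] at hg0
    refine le_of_eq_of_le ?_ zero_le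
    refine (lintegral_congr fun x => ?_).trans lintegral_zero
    rw [lintegral_eq_zero_iff (by fun_prop)]
    filter_upwards [hg0] with y hy
    simp [hy, h₂]
  by_cases hh0 : ∫⁻ x, h x = 0
  · rw [lintegral_eq_zero_iff hh] at hh0
    refine le_of_eq_of_le ?_ zero_le
    refine (lintegral_congr fun x => ?_).trans lintegral_zero
    rw [lintegral_eq_zero_iff (by fun_prop)]
    filter_upwards [(measurePreserving_add_left volume x).quasiMeasurePreserving.ae hh0] with y hy
    simp [hy, h₃]
  have hK : youngConst c₁ c₂ c₃ ≠ 0 := by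
    simp [youngConst, Real.exp_pos]
  have p1 : (∫⁻ x, f x) ^ c₁ ≠ 0 := by simp [hf0, h₁.not_gt]
  have p2 : (∫⁻ x, g x) ^ c₂ ≠ 0 := by simp [hg0, h₂.not_gt]
  have p3 : (∫⁻ x, h x) ^ c₃ ≠ 0 := by simp [hh0, h₃.not_gt]
  by_cases hft : ∫⁻ x, f x = ⊤
  · rw [hft, ENNReal.top_rpow_of_pos h₁, ENNReal.top_mul p2, ENNReal.top_mul p3, ENNReal.mul_top hK]
    exact le_top
  by_cases hgt : ∫⁻ x, g x = ⊤
  · rw [hgt, ENNReal.top_rpow_of_pos h₂, ENNReal.mul_top p1, ENNReal.top_mul p3, ENNReal.mul_top hK]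
    exact le_top
  by_cases hht : ∫⁻ x, h x = ⊤
  · rw [hht, ENNReal.top_rpow_of_pos h₃, ENNReal.mul_top (mul_ne_zero p1 p2), ENNReal.mul_top hK]
    exact le_top
  exact young_trilinear_of_lintegral_ne_top h₁ h₂ h₃ h₁' h₂' h₃' hsum hf hg hh hft hgt hht

/-! ### Tensorisation to dimension `d` -/

theorem lintegral_lintegral_prod_swap {E F : Type*} [MeasureSpace E] [MeasureSpace F]
    [SFinite (volume : Measure E)] [SFinite (volume : Measure F)] {k : E × F → E × F → ENNReal}
    (hk : Measurable (Function.uncurry k)) :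
    ∫⁻ x : E × F, ∫⁻ y : E × F, k x y =
      ∫⁻ x₂ : F, ∫⁻ y₂ : F, ∫⁻ x₁ : E, ∫⁻ y₁ : E, k (x₁, x₂) (y₁, y₂) := by
  have hk1 : Measurable fun x : E × F => ∫⁻ y : E × F, k x y := hk.lintegral_prod_right'
  have hk2 : ∀ x : E × F, Measurable (k x) := fun x => hk.comp measurable_prodMk_left
  rw [Measure.volume_eq_prod] at hk1 ⊢
  rw [lintegral_prod_symm' _ hk1]
  refine lintegral_congr fun x₂ => ?_
  have hk3 : Measurable fun p : E × F => ∫⁻ y₁ : E, k (p.1, x₂) (y₁, p.2) :=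
    Measurable.lintegral_prod_right' (f := fun q : (E × F) × E => k (q.1.1, x₂) (q.2, q.1.2))
      (hk.comp (by fun_prop : Measurable fun q : (E × F) × E => ((q.1.1, x₂), (q.2, q.1.2))))
  rw [← lintegral_lintegral_swap (f := fun x₁ y₂ => ∫⁻ y₁ : E, k (x₁, x₂) (y₁, y₂))
    hk3.aemeasurable]
  exact lintegral_congr fun x₁ => lintegral_prod_symm' _ (hk2 _)

/-- The inequality on `E` is applied on fibres, and the inequality on `F` to the resulting
marginals. -/
theorem TrilinearYoung.prod {E F : Type*} [MeasureSpace E] [MeasureSpace F] [Add E] [Add F]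
    [MeasurableAdd₂ E] [MeasurableAdd₂ F] [SFinite (volume : Measure E)]
    [SFinite (volume : Measure F)] {c₁ c₂ c₃ : ℝ} {K L : ENNReal}
    (hE : TrilinearYoung E c₁ c₂ c₃ K) (hF : TrilinearYoung F c₁ c₂ c₃ L) :
    TrilinearYoung (E × F) c₁ c₂ c₃ (K * L) := by
  intro f g h hf hg hh
  have swap : ∫⁻ x : E × F, ∫⁻ y : E × F, f x ^ c₁ * g y ^ c₂ * h (x + y) ^ c₃ =
      ∫⁻ x₂ : F, ∫⁻ y₂ : F, ∫⁻ x₁ : E, ∫⁻ y₁ : E,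
        f (x₁, x₂) ^ c₁ * g (y₁, y₂) ^ c₂ * h (x₁ + y₁, x₂ + y₂) ^ c₃ :=
    lintegral_lintegral_prod_swap (k := fun x y => f x ^ c₁ * g y ^ c₂ * h (x + y) ^ c₃)
      (by
        change Measurable fun a : (E × F) × (E × F) =>
          f a.1 ^ c₁ * g a.2 ^ c₂ * h (a.1.1 + a.2.1, a.1.2 + a.2.2) ^ c₃
        fun_prop)
  have marg : ∀ {k : E × F → ENNReal}, Measurable k →
      ∫⁻ x₂ : F, ∫⁻ x₁ : E, k (x₁, x₂) = ∫⁻ x, k x := fun hk => by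
    rw [Measure.volume_eq_prod, lintegral_prod_symm' _ hk]
  rw [swap]
  have hF' := hF (fun x₂ => ∫⁻ x₁ : E, f (x₁, x₂)) (fun x₂ => ∫⁻ x₁ : E, g (x₁, x₂))
    (fun x₂ => ∫⁻ x₁ : E, h (x₁, x₂)) (by fun_prop) (by fun_prop) (by fun_prop)
  rw [marg hf, marg hg, marg hh] at hF'
  calc _ ≤ ∫⁻ x₂ : F, ∫⁻ y₂ : F, K * ((∫⁻ x₁ : E, f (x₁, x₂)) ^ c₁ *
        (∫⁻ x₁ : E, g (x₁, y₂)) ^ c₂ * (∫⁻ x₁ : E, h (x₁, x₂ + y₂)) ^ c₃) :=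
        lintegral_mono fun x₂ => lintegral_mono fun y₂ =>
          hE (fun x₁ => f (x₁, x₂)) (fun x₁ => g (x₁, y₂)) (fun x₁ => h (x₁, x₂ + y₂))
            (by fun_prop) (by fun_prop) (by fun_prop)
    _ = K * ∫⁻ x₂ : F, ∫⁻ y₂ : F, ((∫⁻ x₁ : E, f (x₁, x₂)) ^ c₁ *
        (∫⁻ x₁ : E, g (x₁, y₂)) ^ c₂ * (∫⁻ x₁ : E, h (x₁, x₂ + y₂)) ^ c₃) := by
        rw [← lintegral_const_mul _ (by fun_prop)]
        refine lintegral_congr fun x₂ => ?_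
        rw [← lintegral_const_mul _ (by fun_prop)]
    _ ≤ _ := by
        rw [mul_assoc]
        exact mul_le_mul_right hF' K

theorem TrilinearYoung.of_measurePreserving {E F : Type*} [MeasureSpace E] [MeasureSpace F]
    [Add E] [Add F] {c₁ c₂ c₃ : ℝ} {K : ENNReal} (hF : TrilinearYoung F c₁ c₂ c₃ K)
    (e : F ≃ᵐ E) (he : MeasurePreserving e) (hadd : ∀ x y, e (x + y) = e x + e y) :
    TrilinearYoung E c₁ c₂ c₃ K := by
  intro f g h hf hg hh
  have := hF (f ∘ e) (g ∘ e) (h ∘ e) (hf.comp e.measurable) (hg.comp e.measurable)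
    (hh.comp e.measurable)
  simp only [Function.comp, hadd] at this
  simp only [he.lintegral_comp_emb e.measurableEmbedding] at this
  rwa [he.lintegral_comp_emb e.measurableEmbedding
    (fun x => ∫⁻ y, f x ^ c₁ * g (e y) ^ c₂ * h (x + e y) ^ c₃),
    lintegral_congr fun x => he.lintegral_comp_emb e.measurableEmbedding
    (fun y => f x ^ c₁ * g y ^ c₂ * h (x + y) ^ c₃)] at this

theorem trilinearYoung_pi {c₁ c₂ c₃ : ℝ} (h₁ : 0 < c₁) (h₂ : 0 < c₂)
    (h₃ : 0 < c₃) (h₁' : c₁ < 1) (h₂' : c₂ < 1) (h₃' : c₃ < 1) (hsum : c₁ + c₂ + c₃ = 2) (d : ℕ) :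
    TrilinearYoung (Fin d → ℝ) c₁ c₂ c₃ (youngConst c₁ c₂ c₃ ^ d) := by
  induction d with
  | zero =>
    intro f g h hf hg hh
    simp only [Measure.volume_pi_eq_dirac (0 : Fin 0 → ℝ), lintegral_dirac, pow_zero, one_mul, add_zero]
    exact le_rfl
  | succ n ih =>
    rw [pow_succ']
    refine ((trilinearYoung_real h₁ h₂ h₃ h₁' h₂' h₃' hsum).prod ih).of_measurePreserving
      (MeasurableEquiv.piFinSuccAbove (fun _ : Fin (n + 1) => ℝ) 0).symm
      (volume_preserving_piFinSuccAbove (fun _ : Fin (n + 1) => ℝ) 0).symm ?_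
    rintro ⟨x, x'⟩ ⟨y, y'⟩
    ext i
    refine Fin.cases ?_ (fun j => ?_) i <;> simp [MeasurableEquiv.piFinSuccAbove]

/-- Sharp trilinear Young inequality on Euclidean space. -/
theorem trilinearYoung_euclideanSpace {c₁ c₂ c₃ : ℝ} (h₁ : 0 < c₁) (h₂ : 0 < c₂)
    (h₃ : 0 < c₃) (h₁' : c₁ < 1) (h₂' : c₂ < 1) (h₃' : c₃ < 1) (hsum : c₁ + c₂ + c₃ = 2) (d : ℕ) :
    TrilinearYoung (EuclideanSpace ℝ (Fin d)) c₁ c₂ c₃ (youngConst c₁ c₂ c₃ ^ d) :=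
  (trilinearYoung_pi h₁ h₂ h₃ h₁' h₂' h₃' hsum d).of_measurePreserving
    (MeasurableEquiv.toLp 2 (Fin d → ℝ)) (PiLp.volume_preserving_toLp (Fin d)) fun _ _ => rfl

/-! ### Bounds for convolutions: duality and interpolation -/

/-- Jensen for the density `f`, written as Hölder. It covers the case where one entropy power is
zero. -/
theorem lintegral_lconvolution_rpow_le {E : Type*} [MeasureSpace E] [AddGroup E]
    [MeasurableAdd₂ E] [MeasurableNeg E] [SFinite (volume : Measure E)]
    [(volume : Measure E).IsAddLeftInvariant] {p : ℝ} (hp : 1 < p) {f g : E → ENNReal}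
    (hf : Measurable f) (hg : Measurable g) (hf1 : ∫⁻ x, f x = 1) :
    ∫⁻ x, (lconvolution f g volume x) ^ p ≤ ∫⁻ x, g x ^ p := by
  have p0 : 0 < p := by linarith
  have hinv : 1 / p < 1 := by rw [div_lt_one p0]; exact hp
  have hpt : ∀ x, (lconvolution f g volume x) ^ p ≤ ∫⁻ y, f y * g (-y + x) ^ p := by
    intro x
    have h := ENNReal.lintegral_mul_norm_pow_le (μ := volume) (f := f) (g := fun y => f y * g (-y + x) ^ p)
      (by fun_prop) (by fun_prop) (p := 1 - 1 / p) (q := 1 / p) (by linarith) (by positivity)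
      (by ring)
    rw [hf1, ENNReal.one_rpow, one_mul] at h
    have h2 : lconvolution f g volume x ≤ (∫⁻ y, f y * g (-y + x) ^ p) ^ (1 / p) := by
      refine le_of_eq_of_le ?_ h
      refine lintegral_congr fun y => ?_
      rw [ENNReal.mul_rpow_of_nonneg _ _ (by positivity), ← mul_assoc,
        ← ENNReal.rpow_add_of_nonneg _ _ (by linarith) (by positivity), sub_add_cancel,
        ENNReal.rpow_one, ← ENNReal.rpow_mul, mul_one_div_cancel p0.ne', ENNReal.rpow_one]
    calc _ ≤ ((∫⁻ y, f y * g (-y + x) ^ p) ^ (1 / p)) ^ p := ENNReal.rpow_le_rpow h2 p0.le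
      _ = _ := by rw [← ENNReal.rpow_mul, one_div_mul_cancel p0.ne', ENNReal.rpow_one]
  calc _ ≤ ∫⁻ x, ∫⁻ y, f y * g (-y + x) ^ p := lintegral_mono hpt
    _ = ∫⁻ y, ∫⁻ x, f y * g (-y + x) ^ p := lintegral_lintegral_swap (by fun_prop)
    _ = ∫⁻ y, f y * ∫⁻ x, g x ^ p := by
      refine lintegral_congr fun y => ?_
      rw [lintegral_const_mul _ (by fun_prop),
        lintegral_add_left_eq_self (fun x => g x ^ p) (-y)]
    _ = _ := by rw [lintegral_mul_const _ hf, hf1, one_mul]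

theorem lintegral_lconvolution_mul {E : Type*} [MeasureSpace E] [AddGroup E]
    [MeasurableAdd₂ E] [MeasurableNeg E] [SFinite (volume : Measure E)]
    [(volume : Measure E).IsAddLeftInvariant] {f g h : E → ENNReal}
    (hf : Measurable f) (hg : Measurable g) (hh : Measurable h) :
    ∫⁻ x, lconvolution f g volume x * h x = ∫⁻ x, ∫⁻ y, f x * g y * h (x + y) := by
  calc _ = ∫⁻ z, ∫⁻ x, f x * g (-x + z) * h z := by
        refine lintegral_congr fun z => ?_
        rw [lconvolution_def, lintegral_mul_const _ (by fun_prop)]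
    _ = ∫⁻ x, ∫⁻ z, f x * g (-x + z) * h z := lintegral_lintegral_swap (by fun_prop)
    _ = _ := by
      refine lintegral_congr fun x => ?_
      rw [← lintegral_add_left_eq_self _ x]
      simp

theorem le_rpow_of_le_mul_rpow {A J : ENNReal} (hJ : J ≠ ⊤) {p : ℝ} (hp : 1 < p)
    (h : J ≤ A * J ^ (1 - 1 / p)) : J ≤ A ^ p := by
  have p0 : 0 < p := by linarith
  rcases eq_or_ne J 0 with rfl | hJ0
  · exact zero_le
  have hpos : J ^ (1 - 1 / p) ≠ 0 := by simp [ENNReal.rpow_eq_zero_iff, hJ0, hJ]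
  have hfin : J ^ (1 - 1 / p) ≠ ⊤ := by simp [ENNReal.rpow_eq_top_iff, hJ0, hJ]
  have e : J = J ^ (1 / p) * J ^ (1 - 1 / p) := by
    rw [← ENNReal.rpow_add _ _ hJ0 hJ, add_sub_cancel, ENNReal.rpow_one]
  have h2 : J ^ (1 / p) ≤ A := by
    nth_rewrite 1 [e] at h
    exact (ENNReal.mul_le_mul_iff_left hpos hfin).1 h
  calc J = (J ^ (1 / p)) ^ p := by
        rw [← ENNReal.rpow_mul, one_div_mul_cancel p0.ne', ENNReal.rpow_one]
    _ ≤ A ^ p := ENNReal.rpow_le_rpow h2 p0.le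

/-- Duality: the trilinear Young inequality bounds the `L^p` norm of a convolution. -/
theorem TrilinearYoung.lintegral_lconvolution_rpow_le {E : Type*} [MeasureSpace E] [AddGroup E]
    [MeasurableAdd₂ E] [MeasurableNeg E] [SigmaFinite (volume : Measure E)]
    [(volume : Measure E).IsAddLeftInvariant] {c₁ c₂ c₃ p : ℝ} {K : ENNReal} (hp : 1 < p)
    (h₁ : 0 < c₁) (h₂ : 0 < c₂) (h₃ : c₃ = 1 - 1 / p) (hY : TrilinearYoung E c₁ c₂ c₃ K)
    {f g : E → ENNReal} (hf : Measurable f) (hg : Measurable g) :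
    ∫⁻ x, (lconvolution f g volume x) ^ p ≤
      (K * ((∫⁻ x, f x ^ (1 / c₁)) ^ c₁ * (∫⁻ x, g x ^ (1 / c₂)) ^ c₂)) ^ p := by
  subst h₃
  have p0 : 0 < p := by linarith
  set k := lconvolution f g volume with hk
  have mk : Measurable k := measurable_lconvolution volume hf hg
  set A := K * ((∫⁻ x, f x ^ (1 / c₁)) ^ c₁ * (∫⁻ x, g x ^ (1 / c₂)) ^ c₂) with hA
  set S := spanningSets (volume : Measure E) with hS
  -- Truncating in height and support makes `∫ H^p` finite, as `le_rpow_of_le_mul_rpow` needs to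
  -- cancel a power of it.
  set H : ℕ → E → ENNReal := fun n => (S n).indicator fun x => min (k x) n with hH
  have mH : ∀ n, Measurable (H n) := fun n =>
    (mk.min measurable_const).indicator (measurableSet_spanningSets _ n)
  have hHk : ∀ n x, H n x ≤ k x := fun n x => by
    by_cases hx : x ∈ S n <;> simp [hH, hx]
  have hHn : ∀ n x, H n x ≤ (S n).indicator (fun _ => (n : ENNReal)) x := fun n x => by
    by_cases hx : x ∈ S n <;> simp [hH, hx]
  have bound : ∀ n, ∫⁻ x, H n x ^ p ≤ A ^ p := by
    intro n
    refine le_rpow_of_le_mul_rpow ?_ hp ?_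
    · refine ne_top_of_le_ne_top ?_ (lintegral_mono fun x => ENNReal.rpow_le_rpow (hHn n x) p0.le)
      have : ∀ x, (S n).indicator (fun _ => (n : ENNReal)) x ^ p =
          (S n).indicator (fun _ => (n : ENNReal) ^ p) x := fun x => by
        by_cases hx : x ∈ S n <;> simp [hx, p0]
      simp only [this]
      rw [lintegral_indicator_const (measurableSet_spanningSets _ n)]
      exact ENNReal.mul_ne_top (ENNReal.rpow_ne_top_of_nonneg p0.le (by finiteness))
        (measure_spanningSets_lt_top _ n).ne
    · have h := hY (fun x => f x ^ (1 / c₁)) (fun x => g x ^ (1 / c₂)) (fun x => H n x ^ p)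
        (by fun_prop) (by fun_prop) ((mH n).pow_const p)
      have ex : p * (1 - 1 / p) = p - 1 := by field_simp
      simp only [← ENNReal.rpow_mul, one_div_mul_cancel h₁.ne', one_div_mul_cancel h₂.ne',
        ENNReal.rpow_one, ex] at h
      rw [← lintegral_lconvolution_mul hf hg ((mH n).pow_const (p - 1))] at h
      rw [hA, mul_assoc]
      refine le_trans (lintegral_mono fun x => ?_) h
      calc H n x ^ p = H n x * H n x ^ (p - 1) := by
            conv_rhs => rw [← ENNReal.rpow_one (H n x), ← ENNReal.rpow_mul, one_mul]
            rw [← ENNReal.rpow_add_of_nonneg _ _ zero_le_one (by linarith), add_sub_cancel]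
        _ ≤ k x * H n x ^ (p - 1) := mul_le_mul_left (hHk n x) _
  have lim : ∀ x, Filter.Tendsto (fun n => H n x ^ p) Filter.atTop (nhds (k x ^ p)) := by
    intro x
    have h1 : Filter.Tendsto (fun n : ℕ => min (k x) (n : ENNReal)) Filter.atTop
        (nhds (min (k x) ⊤)) := tendsto_const_nhds.min ENNReal.tendsto_nat_nhds_top
    rw [min_eq_left le_top] at h1
    refine Filter.Tendsto.ennrpow_const p (h1.congr' ?_)
    filter_upwards [Filter.eventually_ge_atTop (spanningSetsIndex volume x)] with n hn
    have hx : x ∈ S n := monotone_spanningSets volume hn (mem_spanningSetsIndex volume x)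
    simp [hH, hx]
  calc ∫⁻ x, k x ^ p = ∫⁻ x, Filter.liminf (fun n => H n x ^ p) Filter.atTop :=
        lintegral_congr fun x => (lim x).liminf_eq.symm
    _ ≤ Filter.liminf (fun n => ∫⁻ x, H n x ^ p) Filter.atTop :=
        lintegral_liminf_le fun n => (mH n).pow_const p
    _ ≤ A ^ p := by
        refine (Filter.liminf_le_liminf (Filter.Eventually.of_forall bound)).trans_eq ?_
        exact Filter.liminf_const _

/-- Interpolation of `L^{1/c}` between `L^1` and `L^p` for probability densities. -/
theorem lintegral_rpow_inv_rpow_le {E : Type*} [MeasurableSpace E] {μ : Measure E}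
    {f : E → ENNReal} (hf : Measurable f) (hf1 : ∫⁻ x, f x ∂μ = 1) {p c : ℝ} (hp : 1 < p)
    (hc : 1 / p ≤ c) (hc1 : c ≤ 1) :
    (∫⁻ x, f x ^ (1 / c) ∂μ) ^ c ≤ (∫⁻ x, f x ^ p ∂μ) ^ ((1 - c) / (p - 1)) := by
  have p0 : 0 < p := by linarith
  have hp1 : 0 < p - 1 := by linarith
  have c0 : 0 < c := lt_of_lt_of_le (by positivity) hc
  have hca : 1 ≤ 1 / c := by rw [le_div_iff₀ c0]; linarith
  have hcp : 1 / c ≤ p := by rw [div_le_iff₀ c0]; rw [div_le_iff₀ p0] at hc; linarith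
  -- Chosen so that `1 / c = (1 - v) + v p`.
  set v := (1 / c - 1) / (p - 1) with hv
  have v0 : 0 ≤ v := div_nonneg (by linarith) hp1.le
  have v1 : v ≤ 1 := by rw [hv, div_le_one hp1]; linarith
  have h := ENNReal.lintegral_mul_norm_pow_le (μ := μ) (f := f) (g := fun x => f x ^ p)
    hf.aemeasurable (hf.pow_const p).aemeasurable (p := 1 - v) (q := v) (by linarith) v0 (by ring)
  rw [hf1, ENNReal.one_rpow, one_mul] at h
  have e : ∀ x, f x ^ (1 - v) * (f x ^ p) ^ v = f x ^ (1 / c) := fun x => by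
    rw [← ENNReal.rpow_mul, ← ENNReal.rpow_add_of_nonneg _ _ (by linarith) (by positivity)]
    congr 1
    have : (p - 1) * v = 1 / c - 1 := mul_div_cancel₀ _ hp1.ne'
    linarith
  simp only [e] at h
  calc _ ≤ ((∫⁻ x, f x ^ p ∂μ) ^ v) ^ c := ENNReal.rpow_le_rpow h c0.le
    _ = _ := by
      rw [← ENNReal.rpow_mul]
      congr 1
      rw [hv]
      field_simp

/-- Sharp Young inequality for probability densities in terms of their `L^p` norms only. -/
theorem lintegral_lconvolution_rpow_le_youngConst {d : ℕ} {p : ℝ} (hp : 1 < p)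
    {f g : EuclideanSpace ℝ (Fin d) → ENNReal} (hf : Measurable f) (hg : Measurable g)
    (hf1 : ∫⁻ x, f x = 1) (hg1 : ∫⁻ x, g x = 1) {l : ℝ} (hl0 : 0 < l) (hl1 : l < 1) :
    ∫⁻ x, (lconvolution f g volume x) ^ p ≤
      (youngConst (1 - l * (1 - 1 / p)) (1 - (1 - l) * (1 - 1 / p)) (1 - 1 / p) ^ d) ^ p *
        ((∫⁻ x, f x ^ p) ^ l * (∫⁻ x, g x ^ p) ^ (1 - l)) := by
  have p0 : 0 < p := by linarith
  have hp1 : 0 < p - 1 := by linarith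
  have hip : 0 < 1 / p := by positivity
  obtain ⟨q, hq⟩ : ∃ q, q = 1 - 1 / p := ⟨_, rfl⟩
  have hq0 : 0 < q := by
    have : 1 / p < 1 := by rw [div_lt_one p0]; exact hp
    linarith
  have hq1 : q < 1 := by linarith
  have hlq : l * q < q := by nlinarith
  have hlq' : (1 - l) * q < q := by nlinarith
  have lq0 : 0 < l * q := by positivity
  have lq0' : 0 < (1 - l) * q := mul_pos (by linarith) hq0
  have hY := trilinearYoung_euclideanSpace (c₁ := 1 - l * q) (c₂ := 1 - (1 - l) * q) (c₃ := q)
    (by linarith) (by linarith) hq0 (by linarith) (by linarith) hq1 (by ring) d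
  rw [← hq]
  have h := TrilinearYoung.lintegral_lconvolution_rpow_le hp (by linarith) (by linarith) hq hY hf hg
  refine h.trans ?_
  have i1 := lintegral_rpow_inv_rpow_le hf hf1 hp (c := 1 - l * q) (by linarith) (by linarith)
  have i2 := lintegral_rpow_inv_rpow_le hg hg1 hp (c := 1 - (1 - l) * q) (by linarith)
    (by linarith)
  have e : ∀ m : ℝ, (1 - (1 - m * q)) / (p - 1) * p = m := fun m => by
    rw [hq]
    field_simp
    ring
  rw [ENNReal.mul_rpow_of_nonneg _ _ p0.le]
  gcongr
  refine (ENNReal.rpow_le_rpow (mul_le_mul' i1 i2) p0.le).trans_eq ?_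
  rw [ENNReal.mul_rpow_of_nonneg _ _ p0.le, ← ENNReal.rpow_mul, ← ENNReal.rpow_mul, e, e]

/-! ### From Young's inequality to entropy power -/

theorem renyiEntropyPower_eq_rpow {Ω : Type*} [MeasurableSpace Ω] {d : ℕ} (p : ℝ)
    (X : Ω → EuclideanSpace ℝ (Fin d)) (P : Measure Ω) :
    renyiEntropyPower p X P =
      (∫⁻ x : EuclideanSpace ℝ (Fin d), (pdf X P volume x) ^ p) ^ (-(2 / d / (p - 1))) := by
  rw [renyiEntropyPower, renyiEntropy, ← mul_assoc, ← EReal.coe_mul, ← ENNReal.log_rpow,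
    ENNReal.exp_log]
  congr 1
  rw [← neg_sub p 1, one_div, inv_neg]
  ring

/-- Substitute `A = l (A + B)` and `B = (1 - l) (A + B)`. This `l` lets a geometric mean recover the
sum. -/
theorem rpow_mul_rpow_entropy {A B l : ℝ} (hA : 0 < A) (hB : 0 < B) (hl : l = A / (A + B)) :
    Real.exp (Real.negMulLog l + Real.negMulLog (1 - l)) * (A ^ l * B ^ (1 - l)) = A + B := by
  have hS : 0 < A + B := by positivity
  have hl0 : 0 < l := by rw [hl]; positivity
  have hl' : 1 - l = B / (A + B) := by rw [hl]; field_simp; ring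
  have hl0' : 0 < 1 - l := by rw [hl']; positivity
  have eA : Real.log A = Real.log l + Real.log (A + B) := by
    rw [← Real.log_mul hl0.ne' hS.ne', hl, div_mul_cancel₀ _ hS.ne']
  have eB : Real.log B = Real.log (1 - l) + Real.log (A + B) := by
    rw [← Real.log_mul hl0'.ne' hS.ne', hl', div_mul_cancel₀ _ hS.ne']
  rw [Real.rpow_def_of_pos hA, Real.rpow_def_of_pos hB, ← Real.exp_add, ← Real.exp_add, eA, eB]
  conv_rhs => rw [← Real.exp_log hS]
  congr 1
  simp only [Real.negMulLog]
  ring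

theorem lintegral_rpow_ne_zero {E : Type*} [MeasurableSpace E] {μ : Measure E}
    {f : E → ENNReal} (hf : Measurable f) (hf1 : ∫⁻ x, f x ∂μ = 1) {p : ℝ} (hp : 0 < p) :
    ∫⁻ x, f x ^ p ∂μ ≠ 0 := by
  intro h
  rw [lintegral_eq_zero_iff (hf.pow_const p)] at h
  have : ∫⁻ x, f x ∂μ = 0 := by
    rw [lintegral_eq_zero_iff hf]
    filter_upwards [h] with x hx
    exact (ENNReal.rpow_eq_zero_iff_of_pos hp).1 hx
  simp [this] at hf1

/-- The entropy power inequality for a convolution of densities. -/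
theorem rpow_add_rpow_le_lconvolution {d : ℕ} (hd : 0 < d) {p : ℝ} (hp : 1 < p) {α : ℝ}
    (hα : (p + 1) / 2 ≤ α) {f g : EuclideanSpace ℝ (Fin d) → ENNReal} (hf : Measurable f)
    (hg : Measurable g) (hf1 : ∫⁻ x, f x = 1) (hg1 : ∫⁻ x, g x = 1) :
    ((∫⁻ x, f x ^ p) ^ (-(2 / d / (p - 1) : ℝ))) ^ α +
        ((∫⁻ x, g x ^ p) ^ (-(2 / d / (p - 1) : ℝ))) ^ α ≤
      ((∫⁻ x, (lconvolution f g volume x) ^ p) ^ (-(2 / d / (p - 1) : ℝ))) ^ α := by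
  have p0 : 0 < p := by linarith
  have hp1 : 0 < p - 1 := by linarith
  have α0 : 0 < α := by linarith
  have d0 : (0 : ℝ) < d := by exact_mod_cast hd
  have e0 : 0 < 2 / (d : ℝ) / (p - 1) * α := by positivity
  simp only [← ENNReal.rpow_mul, neg_mul]
  obtain ⟨e, he⟩ : ∃ e, e = 2 / (d : ℝ) / (p - 1) * α := ⟨_, rfl⟩
  rw [← he] at e0 ⊢
  have anti : ∀ {a b : ENNReal}, a ≤ b → b ^ (-e) ≤ a ^ (-e) := fun {a b} hab => by
    rw [ENNReal.rpow_neg, ENNReal.rpow_neg]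
    exact ENNReal.inv_le_inv.2 (ENNReal.rpow_le_rpow hab e0.le)
  have top : (⊤ : ENNReal) ^ (-e) = 0 := ENNReal.top_rpow_of_neg (by linarith)
  -- A divergent integral has entropy power zero, leaving only monotonicity under convolution.
  by_cases hft : ∫⁻ x, f x ^ p = ⊤
  · rw [hft, top, zero_add]
    exact anti (lintegral_lconvolution_rpow_le hp hf hg hf1)
  by_cases hgt : ∫⁻ x, g x ^ p = ⊤
  · rw [hgt, top, add_zero, lconvolution_comm]
    exact anti (lintegral_lconvolution_rpow_le hp hg hf hg1)
  have hf0 := lintegral_rpow_ne_zero hf hf1 p0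
  have hg0 := lintegral_rpow_ne_zero hg hg1 p0
  obtain ⟨a, ha0, ha⟩ : ∃ a : ℝ, 0 < a ∧ ∫⁻ x, f x ^ p = ENNReal.ofReal a :=
    ⟨_, ENNReal.toReal_pos hf0 hft, (ENNReal.ofReal_toReal hft).symm⟩
  obtain ⟨b, hb0, hb⟩ : ∃ b : ℝ, 0 < b ∧ ∫⁻ x, g x ^ p = ENNReal.ofReal b :=
    ⟨_, ENNReal.toReal_pos hg0 hgt, (ENNReal.ofReal_toReal hgt).symm⟩
  obtain ⟨A, hA⟩ : ∃ A, A = a ^ (-e) := ⟨_, rfl⟩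
  obtain ⟨B, hB⟩ : ∃ B, B = b ^ (-e) := ⟨_, rfl⟩
  have A0 : 0 < A := by rw [hA]; positivity
  have B0 : 0 < B := by rw [hB]; positivity
  obtain ⟨l, hl⟩ : ∃ l, l = A / (A + B) := ⟨_, rfl⟩
  have hl0 : 0 < l := by rw [hl]; positivity
  have hl1 : l < 1 := by rw [hl, div_lt_one (by positivity)]; linarith
  have young := lintegral_lconvolution_rpow_le_youngConst hp hf hg hf1 hg1 hl0 hl1
  refine le_trans ?_ (anti young)
  have q0 : 0 < 1 - 1 / p := by
    have : 1 / p < 1 := by rw [div_lt_one p0]; exact hp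
    linarith
  have q1 : 1 - 1 / p < 1 := by
    have : 0 < 1 / p := by positivity
    linarith
  have scal := entropy_le_youngExponent q0 q1 hl0 hl1 (α := α) (by
    refine le_of_eq_of_le ?_ hα
    field_simp
    ring)
  unfold youngConst
  set Ψ := youngExponent (1 - l * (1 - 1 / p)) + youngExponent (1 - (1 - l) * (1 - 1 / p)) +
    youngExponent (1 - 1 / p)
  rw [ha, hb, ENNReal.ofReal_rpow_of_pos ha0, ENNReal.ofReal_rpow_of_pos hb0,
    ← ENNReal.ofReal_add (by positivity) (by positivity),
    ENNReal.ofReal_rpow_of_pos ha0, ENNReal.ofReal_rpow_of_pos hb0,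
    ← ENNReal.ofReal_pow (by positivity), ENNReal.ofReal_rpow_of_pos (by positivity),
    ← ENNReal.ofReal_mul (by positivity), ← ENNReal.ofReal_mul (by positivity),
    ENNReal.ofReal_rpow_of_pos (by positivity)]
  refine ENNReal.ofReal_le_ofReal ?_
  rw [← hA, ← hB, ← rpow_mul_rpow_entropy A0 B0 hl, Real.mul_rpow (by positivity) (by positivity),
    Real.mul_rpow (by positivity) (by positivity), ← Real.rpow_mul ha0.le, ← Real.rpow_mul hb0.le,
    mul_comm l, mul_comm (1 - l), Real.rpow_mul ha0.le, Real.rpow_mul hb0.le, ← hA, ← hB]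
  refine mul_le_mul_of_nonneg_right ?_ (by positivity)
  rw [← Real.exp_nat_mul, ← Real.exp_mul, ← Real.exp_mul, Real.exp_le_exp]
  refine scal.trans_eq ?_
  rw [he]
  field_simp

/-! ### Scaling, and the inequality for random vectors -/

theorem lintegral_comp_smul {d : ℕ} {c : ℝ} (hc : 0 < c)
    {f : EuclideanSpace ℝ (Fin d) → ENNReal} (hf : Measurable f) :
    ∫⁻ x, f (c • x) = ENNReal.ofReal ((c ^ d)⁻¹) * ∫⁻ x, f x := by
  rw [← lintegral_map hf (by fun_prop : Measurable fun x : EuclideanSpace ℝ (Fin d) => c • x),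
    Measure.map_addHaar_smul _ hc.ne', lintegral_smul_measure, finrank_euclideanSpace_fin,
    abs_of_pos (by positivity), smul_eq_mul]

theorem map_smul_eq_withDensity {Ω : Type*} [MeasurableSpace Ω] {P : Measure Ω} {d : ℕ}
    {X : Ω → EuclideanSpace ℝ (Fin d)} [hX : HasPDF X P volume] {c : ℝ} (hc : 0 < c) :
    Measure.map (c • X) P = volume.withDensity
      (fun x => ENNReal.ofReal ((c ^ d)⁻¹) * pdf X P volume (c⁻¹ • x)) := by
  have hm : Measurable fun x : EuclideanSpace ℝ (Fin d) => c • x := by fun_prop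
  have hpm := measurable_pdf X P volume
  have hcomp : c • X = (fun x => c • x) ∘ X := rfl
  rw [hcomp, ← AEMeasurable.map_map_of_aemeasurable hm.aemeasurable hX.aemeasurable',
    map_eq_withDensity_pdf X P volume]
  ext s hs
  rw [Measure.map_apply hm hs, withDensity_apply _ (hm hs), withDensity_apply _ hs,
    ← lintegral_indicator (hm hs), ← lintegral_indicator hs]
  have := lintegral_comp_smul hc (f := s.indicator fun x => pdf X P volume (c⁻¹ • x))
    ((hpm.comp (by fun_prop)).indicator hs)
  have e1 : ∀ x, s.indicator (fun x => pdf X P volume (c⁻¹ • x)) (c • x) =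
      ((fun x => c • x) ⁻¹' s).indicator (pdf X P volume) x := fun x => by
    by_cases hx : c • x ∈ s <;> simp [Set.indicator, hx, smul_smul, hc.ne']
  simp only [e1] at this
  rw [this, ← lintegral_const_mul' _ _ ENNReal.ofReal_ne_top]
  refine lintegral_congr fun x => ?_
  by_cases hx : x ∈ s <;> simp [hx]

theorem hasPDF_smul {Ω : Type*} [MeasurableSpace Ω] {P : Measure Ω} {d : ℕ}
    {X : Ω → EuclideanSpace ℝ (Fin d)} [hX : HasPDF X P volume] {c : ℝ} (hc : 0 < c) :
    HasPDF (c • X) P volume :=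
  hasPDF_of_map_eq_withDensity (hX.aemeasurable'.const_smul c) _
    (((measurable_pdf X P volume).comp (by fun_prop)).const_mul _).aemeasurable
    (map_smul_eq_withDensity hc)

theorem renyiEntropyPower_smul {Ω : Type*} [MeasurableSpace Ω] {P : Measure Ω}
    [IsProbabilityMeasure P] {d : ℕ} (hd : 0 < d)
    {X : Ω → EuclideanSpace ℝ (Fin d)} [hX : HasPDF X P volume] {c : ℝ} (hc : 0 < c) {p : ℝ}
    (hp : 1 < p) :
    renyiEntropyPower p (c • X) P = ENNReal.ofReal (c ^ 2) * renyiEntropyPower p X P := by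
  have p0 : 0 < p := by linarith
  have hp1 : p - 1 ≠ 0 := by linarith
  have d0 : (d : ℝ) ≠ 0 := by exact_mod_cast hd.ne'
  have hpm := measurable_pdf X P volume
  have : HasPDF (c • X) P volume := hasPDF_smul hc
  have hae := (pdf.eq_of_map_eq_withDensity (X := c • X) (μ := volume) _
    (((measurable_pdf X P volume).comp (by fun_prop)).const_mul _).aemeasurable).1
    (map_smul_eq_withDensity hc)
  have hX1 : ∫⁻ x, pdf X P volume x = 1 := by
    rw [pdf.lintegral_eq_measure_univ]; exact measure_univ
  rw [renyiEntropyPower_eq_rpow, renyiEntropyPower_eq_rpow]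
  have hI : ∫⁻ x, pdf (c • X) P volume x ^ p =
      ENNReal.ofReal ((c ^ d)⁻¹ ^ (p - 1)) * ∫⁻ x, pdf X P volume x ^ p := by
    rw [lintegral_congr_ae (hae.mono fun x hx => congrArg (· ^ p) hx)]
    simp only [Function.comp, ENNReal.mul_rpow_of_nonneg _ _ p0.le]
    rw [lintegral_const_mul _ (by fun_prop), ENNReal.ofReal_rpow_of_pos (by positivity)]
    rw [lintegral_comp_smul (inv_pos.2 hc) (f := fun x => pdf X P volume x ^ p) (by fun_prop),
      ← mul_assoc, ← ENNReal.ofReal_mul (by positivity)]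
    congr 2
    rw [inv_pow, inv_inv, Real.rpow_sub_one (by positivity), div_inv_eq_mul]
  -- The outer exponent is negative, so the power splits only once both factors are known to be
  -- nonzero.
  rw [hI, ENNReal.mul_rpow_of_ne_zero (by simp; positivity) (lintegral_rpow_ne_zero hpm hX1 p0),
    ENNReal.ofReal_rpow_of_pos (by positivity)]
  congr 2
  rw [← Real.rpow_mul (by positivity), ← inv_pow, ← Real.rpow_natCast, Real.inv_rpow hc.le,
    Real.inv_rpow (by positivity), ← Real.rpow_neg (by positivity), ← Real.rpow_mul hc.le,
    ← Real.rpow_natCast]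
  congr 1
  push_cast
  field_simp

theorem theorem3 {Ω : Type*} [MeasurableSpace Ω] (P : Measure Ω) [IsProbabilityMeasure P]
    {d : ℕ} (hd : 0 < d) (X Y : Ω → EuclideanSpace ℝ (Fin d))
    (hX : HasPDF X P volume) (hY : HasPDF Y P volume) (hXY : IndepFun X Y P)
    (t : ℝ) (ht0 : 0 < t) (ht1 : t < 1)
    (p : ℝ) (hp : 1 < p) (α : ℝ) (hα : (p + 1) / 2 ≤ α) :
    HasPDF (weightedSum t X Y) P volume ∧
      ENNReal.ofReal t ^ α * renyiEntropyPower p X P ^ α +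
          ENNReal.ofReal (1 - t) ^ α * renyiEntropyPower p Y P ^ α ≤
        renyiEntropyPower p (weightedSum t X Y) P ^ α := by
  have α0 : 0 < α := by linarith
  have s0 : 0 < Real.sqrt t := Real.sqrt_pos.2 ht0
  have s1 : 0 < Real.sqrt (1 - t) := Real.sqrt_pos.2 (by linarith)
  have hsum : weightedSum t X Y = Real.sqrt t • X + Real.sqrt (1 - t) • Y := rfl
  have hU : HasPDF (Real.sqrt t • X) P volume := hasPDF_smul s0
  have hW : HasPDF (Real.sqrt (1 - t) • Y) P volume := hasPDF_smul s1
  have hind : IndepFun (Real.sqrt t • X) (Real.sqrt (1 - t) • Y) P :=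
    hXY.comp (φ := fun x => Real.sqrt t • x) (ψ := fun y => Real.sqrt (1 - t) • y)
      (by fun_prop) (by fun_prop)
  rw [hsum]
  refine ⟨hind.add_hasPDF, ?_⟩
  have hconv := hind.pdf_add_eq_lconvolution_pdf (μ := volume)
  rw [← ENNReal.mul_rpow_of_nonneg _ _ α0.le, ← ENNReal.mul_rpow_of_nonneg _ _ α0.le]
  -- Since entropy power scales quadratically, `t` and `1 - t` are absorbed into the scaled
  -- summands.
  nth_rewrite 1 [← Real.sq_sqrt ht0.le]
  nth_rewrite 1 [← Real.sq_sqrt (by linarith : 0 ≤ 1 - t)]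
  rw [← renyiEntropyPower_smul hd s0 hp, ← renyiEntropyPower_smul hd s1 hp,
    renyiEntropyPower_eq_rpow, renyiEntropyPower_eq_rpow, renyiEntropyPower_eq_rpow,
    lintegral_congr_ae (hconv.mono fun x hx => congrArg (· ^ p) hx)]
  refine rpow_add_rpow_le_lconvolution hd hp hα (measurable_pdf _ _ _) (measurable_pdf _ _ _) ?_ ?_
  · rw [pdf.lintegral_eq_measure_univ]; exact measure_univ
  · rw [pdf.lintegral_eq_measure_univ]; exact measure_univ
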